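/- Let $(X,d,\mu)$ be a metric space with a $\sigma$-finite Borel measure $\mu$, and let $n\ge 0$ be an integer (the "dimension"; it enters only through the estimates below). Let $L$ be a positive (i.e. non-negative) self-adjoint operator on $L^2(X,\mu)$, and let $E_{\sqrt L}(s)=\mathbf 1_{(-\infty,s]}(\sqrt L)$ be the spectral projections of $\sqrt L$. Fix a dense subspace $\mathcal D$ of $L^1\cap L^2$ (for the norm $\|f\|_1+\|f\|_2$). For $s>0$, $dE_{\sqrt L}(s)$ denotes the form $\langle dE_{\sqrt L}(s)f,g\rangle=\frac{d}{ds}\langle E_{\sqrt L}(s)f,g\rangle$, $f,g\in\mathcal D$, whenever these derivatives exist; likewise, for a bounded operator $Q$ on $L^2(X)$, $\langle Q\,dE_{\sqrt L}(s)\,Q^*f,g\rangle=\frac{d}{ds}\langle Q E_{\sqrt L}(s)Q^*f,g\rangle$. Assume: (i) (Factorization of the spectral measure) For every $s>0$, $dE_{\sqrt L}(s)$ exists and $dE_{\sqrt L}(s)=\frac1{2\pi}P(s)P(s)^*$ on $\mathcal D$, where $P(s)$ is a linear map from a Hilbert space $K$ (independent of $s$; for instance $L^2(X)$) to the antilinear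 functionals on $\mathcal D$, with adjoint $P(s)^*:\mathcal D\to K$, $(P(s)u)(g)=\langle u,P(s)^*g\rangle_K$. (ii) (Operator partition of unity) For every $\lambda>0$ there are bounded operators $Q_i(\lambda)$ on $L^2(X)$, $1\le i\le N(\lambda)$, with $\mathrm{Id}=\sum_{i=1}^{N(\lambda)}Q_i(\lambda)$; the norms $\|Q_i(\lambda)\|_{L^2\to L^2}$ and the numbers $N(\lambda)$ are bounded uniformly in $i$ and $\lambda$. (iii) (Spectral measure estimates) There are $\delta\in(0,1)$, a constant $C_0$ and a function $w:X\times X\to[0,\infty)$ such that for every $\lambda>0$ in the essential spectrum of $\sqrt L$ and every $1\le i\le N(\lambda)$ there is a function $\kappa_s(z,z')$ such that, for every $s$ with $s/\lambda\in(1-\delta,1+\delta)$, $\kappa_s$ is measurable and is the integral kernel of $Q_i(\lambda)\,dE_{\sqrt L}(s)\,Q_i(\lambda)^*$ on $\mathcal D$ (whose existence is part of the assumption), and such that for almost every $(z,z')\in X\times X$ the function $s\mapsto\kappa_s(z,z')$ is of class $C^{m}$, $m=\lfloor (n+1)/2\rfloor$, on $((1-\delta)\lambda,(1+\delta)\lambda)$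 with $$\Big|\frac{\partial^k}{\partial s^k}\kappa_s(z,z')\Big|\le C_0\,s^{\,n-1-k}\,\bigl(1+s\,w(z,z')\bigr)^{-(n-1)/2+k},\qquad 0\le k\le m .$$ Then there is a constant $C$ such that for all $p\in\bigl[1,\tfrac{2(n+1)}{n+3}\bigr]$, with $\frac1p+\frac1{p'}=1$, and all $\lambda>0$, the form $dE_{\sqrt L}(\lambda)$ extends from $\mathcal D$ to a bounded operator $L^p(X)\to L^{p'}(X)$ with $$\|dE_{\sqrt L}(\lambda)\|_{L^p\to L^{p'}}\le C\,\lambda^{\,n(1/p-1/p')-1}.$$ -/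

import Mathlib

open MeasureTheory Set Filter Topology
open scoped ENNReal

noncomputable section

section Hilbert

variable {H : Type*} [NormedAddCommGroup H] [InnerProductSpace ℂ H] [CompleteSpace H]

/-- A spectral family (resolution of the identity) on a complex Hilbert space: `toFun t` plays the
role of the spectral projection `E((-∞, t])`. -/
structure SpectralFamily (H : Type*) [NormedAddCommGroup H] [InnerProductSpace ℂ H]
    [CompleteSpace H] where
  toFun : ℝ → H →L[ℂ] H
  isStarProjection : ∀ t, IsStarProjection (toFun t)
  mul_of_le : ∀ s t, s ≤ t → toFun s * toFun t = toFun s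
  right_continuous : ∀ (f : H) (t : ℝ), ContinuousWithinAt (fun s => toFun s f) (Ici t) t
  tendsto_atBot : ∀ f : H, Tendsto (fun t => toFun t f) atBot (𝓝 0)
  tendsto_atTop : ∀ f : H, Tendsto (fun t => toFun t f) atTop (𝓝 f)

/-- The distribution function `t ↦ ‖E t f‖² = ⟨E t f, f⟩` of the scalar spectral measure of `f`. -/
def SpectralFamily.stieltjes (E : SpectralFamily H) (f : H) : StieltjesFunction ℝ where
  toFun t := ‖E.toFun t f‖ ^ 2
  mono' := by
    intro s t hst
    have h1 : E.toFun s f = E.toFun s (E.toFun t f) :=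
      (DFunLike.congr_fun (E.mul_of_le s t hst) f).symm
    have h2 : ‖E.toFun s f‖ ≤ ‖E.toFun t f‖ := by
      rw [h1]
      calc ‖E.toFun s (E.toFun t f)‖ ≤ ‖E.toFun s‖ * ‖E.toFun t f‖ :=
            (E.toFun s).le_opNorm _
        _ ≤ 1 * ‖E.toFun t f‖ := by
            gcongr
            exact (E.isStarProjection s).norm_le
        _ = ‖E.toFun t f‖ := one_mul _
    show ‖E.toFun s f‖ ^ 2 ≤ ‖E.toFun t f‖ ^ 2
    gcongr
  right_continuous' t := (E.right_continuous f t).norm.pow 2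

/-- The scalar spectral measure `d⟨E(t) f, f⟩` of the vector `f`. -/
def SpectralFamily.measure (E : SpectralFamily H) (f : H) : Measure ℝ :=
  (E.stieltjes f).measure

/-- `A = ∫ t dE(t)`: the domain of `A` consists of the `f` with `∫ t² d⟨E(t) f, f⟩ < ∞`, and
`⟨A f, f⟩ = ∫ t d⟨E(t) f, f⟩` on it (by polarization this determines `A`). -/
def IsSpectralFamilyOf (E : SpectralFamily H) (A : H →ₗ.[ℂ] H) : Prop :=
  (∀ f : H, f ∈ A.domain ↔ Integrable (fun t : ℝ => t ^ 2) (E.measure f)) ∧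
  ∀ f : A.domain, inner ℂ (f : H) (A f) = ((∫ t : ℝ, t ∂(E.measure (f : H)) : ℝ) : ℂ)

open Classical in
/-- The spectral projections `E_A((-∞, t])` of a self-adjoint operator `A`: the spectral family
`E` with `A = ∫ t dE(t)`. By the spectral theorem it exists and is unique for every self-adjoint
`A`; the value `0` is a default for operators that are not self-adjoint. -/
def spectralProj (A : H →ₗ.[ℂ] H) : ℝ → H →L[ℂ] H :=
  if h : ∃ E : SpectralFamily H, IsSpectralFamilyOf E A then h.choose.toFun else 0

/-- The spectral projections `E_{√L}((-∞, s])` of the square root of a positive self-adjoint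
operator `L`: the image of the spectral measure of `L` under the square root. -/
def sqrtSpectralProj (L : H →ₗ.[ℂ] H) (s : ℝ) : H →L[ℂ] H :=
  if s < 0 then 0 else spectralProj L (s ^ 2)

/-- The essential spectrum of the self-adjoint operator with spectral projections
`E s = E((-∞, s])`: every interval `(s - ε, s + ε]` has a spectral projection of infinite rank. -/
def essSpectrum (E : ℝ → H →L[ℂ] H) : Set ℝ :=
  {s | ∀ ε : ℝ, 0 < ε →
    ¬ FiniteDimensional ℂ (LinearMap.range (E (s + ε) - E (s - ε) : H →L[ℂ] H).toLinearMap)}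

/-- `⟨dE(s) f, g⟩ = c`, where `dE(s)` is the derivative at `s`, in the sense of sesquilinear
forms, of the operator-valued function `E`. -/
def HasSpectralDensityAt (E : ℝ → H →L[ℂ] H) (s : ℝ) (f g : H) (c : ℂ) : Prop :=
  HasDerivAt (fun t : ℝ => inner ℂ g (E t f)) c s

end Hilbert

section MetricMeasureSpace

variable {X : Type*} [MeasurableSpace X] {μ : Measure X}

/-- `D` is a dense subspace of `L¹ ∩ L²` with its norm `‖f‖₁ + ‖f‖₂` (for instance `L¹ ∩ L²`, or
the continuous functions with compact support on a nice space). -/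
def IsTestSpace (D : Submodule ℂ (Lp ℂ 2 μ)) : Prop :=
  (∀ f ∈ D, MemLp (f : X → ℂ) 1 μ) ∧
  ∀ h : Lp ℂ 2 μ, MemLp (h : X → ℂ) 1 μ → ∀ ε : ℝ≥0∞, 0 < ε →
    ∃ f ∈ D, eLpNorm ((h : X → ℂ) - (f : X → ℂ)) 1 μ < ε ∧
      eLpNorm ((h : X → ℂ) - (f : X → ℂ)) 2 μ < ε

/-- Factorization `dE(s) = (2π)⁻¹ P(s) P(s)*` for all `s > 0`, as operators from the test space `D`
to its antidual. Here `P s` maps a Hilbert space `K` to generalized functions (antilinear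
functionals on `D`), and `Pstar s` is its adjoint. -/
def SpectralFactorization (E : ℝ → Lp ℂ 2 μ →L[ℂ] Lp ℂ 2 μ) (D : Submodule ℂ (Lp ℂ 2 μ))
    {K : Type*} [NormedAddCommGroup K] [InnerProductSpace ℂ K]
    (P : ℝ → K →ₗ[ℂ] (D →ₗ⋆[ℂ] ℂ)) (Pstar : ℝ → D →ₗ[ℂ] K) : Prop :=
  ∀ s : ℝ, 0 < s →
    (∀ (u : K) (g : D), P s u g = inner ℂ (Pstar s g) u) ∧
    ∀ f g : D, HasSpectralDensityAt E s (f : Lp ℂ 2 μ) (g : Lp ℂ 2 μ)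
      ((1 / (2 * (Real.pi : ℂ))) * P s (Pstar s f) g)

/-- Operator partition of unity: for every `s > 0`, the identity is the sum of `Q s 0, …,
Q s (N s - 1)`; these operators and the number of them are bounded uniformly in `s`. -/
def OperatorPartition (N : ℝ → ℕ) (Q : ℝ → ℕ → Lp ℂ 2 μ →L[ℂ] Lp ℂ 2 μ) : Prop :=
  (∃ N₀ : ℕ, ∀ s : ℝ, 0 < s → N s ≤ N₀) ∧
  (∃ B : ℝ, ∀ s : ℝ, 0 < s → ∀ i < N s, ‖Q s i‖ ≤ B) ∧
  ∀ s : ℝ, 0 < s → ∑ i ∈ Finset.range (N s), Q s i = ContinuousLinearMap.id ℂ (Lp ℂ 2 μ)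

/-- Localized spectral measure estimates: for every `lam > 0` in the essential spectrum and every
`i`, the operators `Q_i(lam) dE(s) Q_i(lam)*` with `|s / lam - 1| < δ` have an integral kernel
`κ s z z'` which is differentiable in `s` up to the order `⌊(n + 1) / 2⌋` and satisfies
`|∂_s^k κ s z z'| ≤ C s^(n - 1 - k) (1 + s w(z, z'))^(- (n - 1) / 2 + k)` for these orders `k`.
The numbers `δ` and `C` and the function `w` do not depend on `lam`, `i`, `s`, `k`. -/
def SpectralMeasureEstimates (n : ℕ) (E : ℝ → Lp ℂ 2 μ →L[ℂ] Lp ℂ 2 μ)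
    (D : Submodule ℂ (Lp ℂ 2 μ)) (N : ℝ → ℕ) (Q : ℝ → ℕ → Lp ℂ 2 μ →L[ℂ] Lp ℂ 2 μ)
    (w : X → X → ℝ) (δ C : ℝ) : Prop :=
  ∀ lam ∈ essSpectrum E, 0 < lam → ∀ i < N lam, ∃ κ : ℝ → X → X → ℂ,
    (∀ s ∈ Ioo ((1 - δ) * lam) ((1 + δ) * lam),
      AEStronglyMeasurable (fun x : X × X => κ s x.1 x.2) (μ.prod μ) ∧
      ∀ f ∈ D, ∀ g ∈ D,
        HasSpectralDensityAt
          (fun t => (Q lam i).comp ((E t).comp (ContinuousLinearMap.adjoint (Q lam i)))) s f g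
          (∫ x : X × X, κ s x.1 x.2 * f x.2 * starRingEnd ℂ (g x.1) ∂(μ.prod μ))) ∧
    ∀ᵐ x : X × X ∂(μ.prod μ),
      ContDiffOn ℝ ((n + 1) / 2 : ℕ) (fun s => κ s x.1 x.2)
        (Ioo ((1 - δ) * lam) ((1 + δ) * lam)) ∧
      ∀ k ≤ (n + 1) / 2, ∀ s ∈ Ioo ((1 - δ) * lam) ((1 + δ) * lam),
        ‖iteratedDeriv k (fun t => κ t x.1 x.2) s‖ ≤
          C * s ^ ((n : ℝ) - 1 - k) * (1 + s * w x.1 x.2) ^ (-((n : ℝ) - 1) / 2 + k)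

/-- `T : Lᵖ → L^q` is the continuous extension of `dE(s)`, which is given on the test space `D`. -/
def IsSpectralMeasureOperator (E : ℝ → Lp ℂ 2 μ →L[ℂ] Lp ℂ 2 μ) (D : Submodule ℂ (Lp ℂ 2 μ))
    (s : ℝ) {p q : ℝ≥0∞} [Fact (1 ≤ p)] [Fact (1 ≤ q)] (T : Lp ℂ p μ →L[ℂ] Lp ℂ q μ) : Prop :=
  ∀ f ∈ D, ∀ g ∈ D, ∀ u : Lp ℂ p μ, (u : X → ℂ) =ᵐ[μ] (f : X → ℂ) →
    HasSpectralDensityAt E s f g (∫ z, (T u : X → ℂ) z * starRingEnd ℂ (g z) ∂μ)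

end MetricMeasureSpace

end

/-! Fix `lam` and put `θ = 1/p - 1/p'`. Stein interpolation in the analytic family of fractional
derivatives of the spectral measure is replaced here by a dyadic version that uses only real
increments of the projections.

For each `Q = Q_i(lam)`, the density of `Q E(s) Q*` at `lam` is the limit of operators `a_J`. These
combine mean derivatives of `Q E Q*` over intervals to the left of `lam`, at scale `2^(-J)`, with
coefficients chosen so that the error of `a_J` is a finite difference of order `m = ⌊(n+1)/2⌋`.
Write `a_J = T_0 + ... + T_J` with increments `T_j`. Two weighted sums are bounded uniformly in `J`.

On `L²`, if `|c_j| ≤ 2^(-j)`, then `∑ c_j T_j` is `O(1/lam)`: a mean derivative at scale `2^(-j)` is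
a spectral projection times a multiple of `2^j / lam`, and the intervals at successive scales are
adjacent, so the projections are mutually orthogonal
(`IsProjectionFamily.norm_sum_mul_increments_le`).

From `L¹` to `L^∞`, if `|c_j| ≤ 2^((n-1)j/2)`, then `∑ c_j T_j` is `O(lam^(n-1))`. With `W = 1 + lam
w`, the kernel estimates of orders `m` and `n-1-m` bound the error of `a_j` by `2^(-(n-1)j/2)
min(2^j/W, W/2^j)^σ` with `σ > 0`. The weights leave a two-sided geometric series whose sum does not
depend on `W` (`norm_sum_mul_increments_extrapolation_le`).

The three lines theorem is applied with the weights `2^((z/θ-1)j)`, which equal `1` at `z = θ`. On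
`Re z = 1` they are admissible exactly if `1/θ ≤ (n+1)/2`, that is `p ≤ 2(n+1)/(n+3)`. The resulting
power is `lam^(-(1-θ)) lam^((n-1)θ) = lam^(nθ-1)`.

Only diagonal terms `⟨Q_i dE Q_i* f, f⟩` are needed: since `f = ∑ Q_i* f` and `dE` is positive,
Cauchy-Schwarz bounds `⟨dE f, f⟩` by them. Hence `P(lam)*` is bounded from `Lᵖ` to `K`, and `dE =
(2π)⁻¹ P P*` is bounded from `Lᵖ` to its antidual, which is identified with `L^q`. Outside the
essential spectrum `E` is locally constant and the density is zero. -/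

/-! ### Monotone families of projections: orthogonality of increments, and local constancy off the
essential spectrum. -/

section ProjectionFamilies

variable {H : Type*} [NormedAddCommGroup H] [InnerProductSpace ℂ H] [CompleteSpace H]

/-- A monotone family of orthogonal projections. -/
structure IsProjectionFamily (E : ℝ → H →L[ℂ] H) : Prop where
  isStarProjection : ∀ t, IsStarProjection (E t)
  mul_of_le : ∀ s t, s ≤ t → E s * E t = E s

theorem isProjectionFamily_spectralProj (A : H →ₗ.[ℂ] H) :
    IsProjectionFamily (spectralProj A) := by
  unfold spectralProj
  split_ifs with h
  · exact ⟨h.choose.isStarProjection, h.choose.mul_of_le⟩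
  -- The default value, the zero family, is also a monotone family of projections, so the existence
  -- of a spectral family is never needed.
  · exact ⟨fun t => ⟨by simp [IsIdempotentElem], by simp [IsSelfAdjoint]⟩, fun s t _ => by simp⟩

theorem isProjectionFamily_sqrtSpectralProj (A : H →ₗ.[ℂ] H) :
    IsProjectionFamily (sqrtSpectralProj A) where
  isStarProjection t := by
    unfold sqrtSpectralProj
    split_ifs with h
    · exact ⟨by simp [IsIdempotentElem], by simp [IsSelfAdjoint]⟩
    · exact (isProjectionFamily_spectralProj A).isStarProjection _
  mul_of_le s t hst := by
    unfold sqrtSpectralProj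
    split_ifs with h1 h2 h2
    · simp
    · simp
    · linarith
    · exact (isProjectionFamily_spectralProj A).mul_of_le _ _ (by gcongr; linarith)

namespace IsProjectionFamily

variable {E : ℝ → H →L[ℂ] H} (hE : IsProjectionFamily E)
include hE

theorem mul_of_ge {s t : ℝ} (hst : s ≤ t) : E t * E s = E s := by
  have h := congrArg star (hE.mul_of_le s t hst)
  rwa [star_mul, (hE.isStarProjection s).isSelfAdjoint.star_eq,
    (hE.isStarProjection t).isSelfAdjoint.star_eq] at h

theorem isStarProjection_sub {s t : ℝ} (hst : s ≤ t) : IsStarProjection (E t - E s) := by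
  refine ⟨?_, (hE.isStarProjection t).isSelfAdjoint.sub (hE.isStarProjection s).isSelfAdjoint⟩
  have h1 := (hE.isStarProjection t).isIdempotentElem
  have h2 := (hE.isStarProjection s).isIdempotentElem
  unfold IsIdempotentElem at *
  rw [mul_sub, sub_mul, sub_mul, h1, h2, hE.mul_of_le _ _ hst, hE.mul_of_ge hst]
  abel

end IsProjectionFamily

theorem IsStarProjection.inner_apply {F : H →L[ℂ] H} (hF : IsStarProjection F) (f g : H) :
    inner ℂ g (F f) = inner ℂ (F g) (F f) := by
  have h1 : F (F f) = F f := DFunLike.congr_fun hF.isIdempotentElem f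
  have h2 : ContinuousLinearMap.adjoint F = F := hF.isSelfAdjoint.star_eq
  conv_lhs => rw [← h1, ← h2]
  rw [ContinuousLinearMap.adjoint_inner_right, h2]

theorem IsStarProjection.inner_self_apply {F : H →L[ℂ] H} (hF : IsStarProjection F) (f : H) :
    inner ℂ f (F f) = ((‖F f‖ ^ 2 : ℝ) : ℂ) := by
  rw [hF.inner_apply, inner_self_eq_norm_sq_to_K]
  simp

theorem IsStarProjection.norm_apply_le {F : H →L[ℂ] H} (hF : IsStarProjection F) (f : H) :
    ‖F f‖ ≤ ‖f‖ := by
  simpa using F.le_of_opNorm_le hF.norm_le f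

namespace IsProjectionFamily

variable {E : ℝ → H →L[ℂ] H} (hE : IsProjectionFamily E)
include hE

theorem norm_sub_apply_sq {s t : ℝ} (hst : s ≤ t) (f : H) :
    ‖(E t - E s) f‖ ^ 2 = ‖E t f‖ ^ 2 - ‖E s f‖ ^ 2 := by
  have h : ((‖(E t - E s) f‖ ^ 2 : ℝ) : ℂ) = ((‖E t f‖ ^ 2 - ‖E s f‖ ^ 2 : ℝ) : ℂ) := by
    rw [← (hE.isStarProjection_sub hst).inner_self_apply, Complex.ofReal_sub,
      ← (hE.isStarProjection t).inner_self_apply, ← (hE.isStarProjection s).inner_self_apply,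
      sub_apply, inner_sub_right]
  exact_mod_cast h

/-- Bessel inequality for the spectral increments over consecutive intervals. -/
theorem sum_norm_sub_apply_sq_le {s : ℕ → ℝ} (hs : Monotone s) (J : ℕ) (f : H) :
    ∑ j ∈ Finset.range J, ‖(E (s (j + 1)) - E (s j)) f‖ ^ 2 ≤ ‖f‖ ^ 2 := by
  have h : ∀ j, ‖(E (s (j + 1)) - E (s j)) f‖ ^ 2 = ‖E (s (j + 1)) f‖ ^ 2 - ‖E (s j) f‖ ^ 2 :=
    fun j => hE.norm_sub_apply_sq (hs (Nat.le_succ j)) f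
  simp_rw [h]
  rw [Finset.sum_range_sub (fun j => ‖E (s j) f‖ ^ 2)]
  have := (hE.isStarProjection (s J)).norm_apply_le f
  nlinarith [norm_nonneg (E (s J) f), sq_nonneg ‖E (s 0) f‖]

/-- A bounded multiplier that is constant on consecutive intervals is a bounded operator. -/
theorem norm_sum_mul_inner_le {s : ℕ → ℝ} (hs : Monotone s) {J : ℕ} {c : ℕ → ℂ} {M : ℝ}
    (hc : ∀ j, ‖c j‖ ≤ M) (f g : H) :
    ‖∑ j ∈ Finset.range J, c j * inner ℂ g ((E (s (j + 1)) - E (s j)) f)‖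
      ≤ M * (‖f‖ * ‖g‖) := by
  have hM : 0 ≤ M := (norm_nonneg _).trans (hc 0)
  have h1 := hE.sum_norm_sub_apply_sq_le hs J f
  have h2 := hE.sum_norm_sub_apply_sq_le hs J g
  have h3 := Finset.sum_mul_sq_le_sq_mul_sq (Finset.range J)
    (fun j => ‖(E (s (j + 1)) - E (s j)) g‖) (fun j => ‖(E (s (j + 1)) - E (s j)) f‖)
  have h4 : ∑ j ∈ Finset.range J, ‖(E (s (j + 1)) - E (s j)) g‖ * ‖(E (s (j + 1)) - E (s j)) f‖
      ≤ ‖f‖ * ‖g‖ := by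
    refine abs_le_of_sq_le_sq' ?_ (by positivity) |>.2
    refine h3.trans ?_
    calc _ ≤ ‖g‖ ^ 2 * ‖f‖ ^ 2 := by gcongr
      _ = _ := by ring
  calc _ ≤ ∑ j ∈ Finset.range J, ‖c j * inner ℂ g ((E (s (j + 1)) - E (s j)) f)‖ :=
        norm_sum_le _ _
    _ ≤ ∑ j ∈ Finset.range J,
          M * (‖(E (s (j + 1)) - E (s j)) g‖ * ‖(E (s (j + 1)) - E (s j)) f‖) := by
        refine Finset.sum_le_sum fun j _ => ?_
        rw [norm_mul, (hE.isStarProjection_sub (hs (Nat.le_succ j))).inner_apply]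
        gcongr
        · exact hc j
        · exact norm_inner_le_norm _ _
    _ ≤ _ := by
        rw [← Finset.mul_sum]
        gcongr

/-- Away from the essential spectrum, a spectral family which is weakly continuous on a dense set
is locally constant. -/
theorem eventually_eq_of_notMem_essSpectrum {D : Set H} (hD : Dense D) {a : ℝ}
    (ha : a ∉ essSpectrum E)
    (hcont : ∀ f ∈ D, ContinuousAt (fun t => inner ℂ f (E t f)) a) :
    ∀ᶠ t in 𝓝 a, E t = E a := by
  simp only [essSpectrum, mem_ofPred_eq, not_forall, not_not] at ha
  obtain ⟨ε, hε, hfin⟩ := ha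
  -- A difference of nested projections satisfies `⟨f, (E t - E a) f⟩ = ±‖(E t - E a) f‖²`, so
  -- continuity of the diagonal coefficients is already strong continuity.
  have hstrongD : ∀ f ∈ D, Tendsto (fun t => ‖(E t - E a) f‖) (𝓝 a) (𝓝 0) := by
    intro f hf
    have h1 : Tendsto (fun t => ‖inner ℂ f (E t f) - inner ℂ f (E a f)‖) (𝓝 a) (𝓝 0) := by
      rw [← tendsto_iff_norm_sub_tendsto_zero]
      exact hcont f hf
    have h2 : ∀ t, ‖inner ℂ f (E t f) - inner ℂ f (E a f)‖ = ‖(E t - E a) f‖ ^ 2 := by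
      intro t
      rw [← inner_sub_right, ← sub_apply]
      rcases le_total a t with h | h
      · rw [(hE.isStarProjection_sub h).inner_self_apply, Complex.norm_real]
        simp
      · rw [← neg_sub, neg_apply, inner_neg_right,
          (hE.isStarProjection_sub h).inner_self_apply, norm_neg, Complex.norm_real]
        simp [norm_sub_rev]
    simp_rw [h2] at h1
    have h3 := h1.sqrt
    simpa using h3
  have hnorm : ∀ t f, ‖(E t - E a) f‖ ≤ ‖f‖ := by
    intro t f
    rcases le_total a t with h | h
    · exact (hE.isStarProjection_sub h).norm_apply_le f
    · rw [← neg_sub, neg_apply, norm_neg]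
      exact (hE.isStarProjection_sub h).norm_apply_le f
  have hstrong : ∀ f, Tendsto (fun t => ‖(E t - E a) f‖) (𝓝 a) (𝓝 0) := by
    intro f
    rw [Metric.tendsto_nhds]
    intro η hη
    obtain ⟨d, hd, hfd⟩ := Metric.dense_iff.1 hD f (η / 2) (by positivity)
    filter_upwards [(Metric.tendsto_nhds.1 (hstrongD _ hfd)) (η / 2) (by positivity)] with t ht
    simp only [dist_zero_right, norm_norm] at ht ⊢
    rw [Metric.mem_ball, dist_eq_norm, ← norm_sub_rev] at hd
    calc ‖(E t - E a) f‖ = ‖(E t - E a) (f - d) + (E t - E a) d‖ := by rw [← map_add]; simp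
      _ ≤ ‖f - d‖ + ‖(E t - E a) d‖ := (norm_add_le _ _).trans (by gcongr; exact hnorm _ _)
      _ < η := by linarith
  set V := LinearMap.range (E (a + ε) - E (a - ε) : H →L[ℂ] H).toLinearMap with hV
  set b := stdOrthonormalBasis ℂ V
  -- On the finite-dimensional `V`, strong convergence is uniform: the sum over an orthonormal basis
  -- dominates the operator norm of `E t - E a` on `V`.
  have hsum : Tendsto (fun t => ∑ i, ‖(E t - E a) (b i : H)‖) (𝓝 a) (𝓝 0) := by
    simpa using tendsto_finsetSum Finset.univ fun i _ => hstrong (b i : H)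
  filter_upwards [(tendsto_order.1 hsum).2 1 one_pos,
    Ioo_mem_nhds (show a - ε < a by linarith) (show a < a + ε by linarith)] with t ht htI
  have hmemV : ∀ f, (E t - E a) f ∈ V := by
    intro f
    refine ⟨(E t - E a) f, ?_⟩
    have : (E (a + ε) - E (a - ε)) * (E t - E a) = E t - E a := by
      rw [sub_mul, mul_sub, mul_sub, hE.mul_of_ge htI.2.le, hE.mul_of_ge (by linarith),
        hE.mul_of_le _ _ htI.1.le, hE.mul_of_le _ _ (by linarith)]
      abel
    exact DFunLike.congr_fun this f
  have hVbound : ∀ v ∈ V, ‖(E t - E a) v‖ ≤ (∑ i, ‖(E t - E a) (b i : H)‖) * ‖v‖ := by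
    intro v hv
    have h1 : v = ∑ i, (inner ℂ (b i : H) v) • (b i : H) := by
      have := congrArg (Submodule.subtype V) (b.sum_repr' ⟨v, hv⟩)
      simpa using this.symm
    conv_lhs => rw [h1]
    rw [map_sum, Finset.sum_mul]
    refine (norm_sum_le _ _).trans (Finset.sum_le_sum fun i _ => ?_)
    rw [map_smul, norm_smul, mul_comm]
    gcongr
    have hb : ‖(b i : H)‖ = 1 := b.orthonormal.1 i
    simpa [hb] using norm_inner_le_norm (𝕜 := ℂ) (b i : H) v
  refine ContinuousLinearMap.ext fun f => ?_
  have hidem : ‖(E t - E a) ((E t - E a) f)‖ = ‖(E t - E a) f‖ := by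
    rcases le_total a t with h | h
    · have := DFunLike.congr_fun (hE.isStarProjection_sub h).isIdempotentElem f
      exact congrArg norm this
    · have := DFunLike.congr_fun (hE.isStarProjection_sub h).isIdempotentElem f
      rw [← neg_sub, neg_apply, neg_apply, map_neg,
        neg_neg, norm_neg]
      exact congrArg norm this
  -- Up to sign, `E t - E a` is a projection with range in `V`; as its norm on `V` is less than `1`,
  -- it vanishes.
  have h0 := hVbound _ (hmemV f)
  rw [hidem] at h0
  have h5 : ‖(E t - E a) f‖ = 0 := by
    nlinarith [norm_nonneg ((E t - E a) f)]
  exact sub_eq_zero.1 (norm_eq_zero.1 h5)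

end IsProjectionFamily

end ProjectionFamilies

/-! ### Finite differences, extrapolation to zero, and summation by parts. -/

section FiniteDifferences

theorem hasDerivAt_fwdDiff_iter {F : Type*} [NormedAddCommGroup F] [NormedSpace ℝ F]
    (m : ℕ) (τ : ℝ) {h : ℝ → F} {x : ℝ}
    (hd : ∀ r ≤ m, DifferentiableAt ℝ h (x + r • τ)) :
    HasDerivAt ((fwdDiff τ)^[m] h) ((fwdDiff τ)^[m] (deriv h) x) x := by
  have h1 : (fwdDiff τ)^[m] h = fun y => ∑ r ∈ Finset.range (m + 1),
      ((-1 : ℤ) ^ (m - r) * (m.choose r : ℤ)) • h (y + r • τ) :=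
    funext fun y => fwdDiff_iter_eq_sum_shift _ _ _ _
  rw [h1, fwdDiff_iter_eq_sum_shift]
  refine HasDerivAt.fun_sum fun r hr => ?_
  have h2 := (hd r (Nat.lt_succ_iff.1 (Finset.mem_range.1 hr))).hasDerivAt.comp_add_const x (r • τ)
  exact HasDerivAt.fun_const_smul ((-1 : ℤ) ^ (m - r) * (m.choose r : ℤ)) h2

/-- Bound for the forward difference of order `m` by the derivative of order `k ≤ m`. -/
theorem norm_fwdDiff_iter_le {F : Type*} [NormedAddCommGroup F] [NormedSpace ℝ F]
    {a b M : ℝ} (k : ℕ) : ∀ (m : ℕ) (τ : ℝ) (h : ℝ → F) (x : ℝ), k ≤ m →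
    ContDiffOn ℝ k h (Ioo a b) → (∀ s ∈ Ioo a b, ‖iteratedDeriv k h s‖ ≤ M) →
    x ∈ Ioo a b → x + m • τ ∈ Ioo a b →
    ‖(fwdDiff τ)^[m] h x‖ ≤ 2 ^ m * |τ| ^ k * M := by
  have hconv : ∀ {m : ℕ} {τ x : ℝ}, x ∈ Ioo a b → x + m • τ ∈ Ioo a b → ∀ r ≤ m,
      x + r • τ ∈ Ioo a b := by
    intro m τ x hx hm r hr
    have h1 : (r : ℝ) ≤ m := by exact_mod_cast hr
    have h0 : (0 : ℝ) ≤ r := by positivity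
    simp only [nsmul_eq_mul, mem_Ioo] at *
    rcases le_total 0 τ with h | h
    · constructor <;> nlinarith
    · constructor <;> nlinarith
  have hrec : ∀ (m : ℕ) (τ x : ℝ) (h : ℝ → F), (fwdDiff τ)^[m + 1] h x =
      (fwdDiff τ)^[m] h (x + τ) - (fwdDiff τ)^[m] h x := by
    intro m τ x h
    rw [Function.iterate_succ_apply']
    rfl
  induction k with
  | zero =>
    intro m
    induction m with
    | zero =>
      intro τ h x _ _ hM hx _
      simpa using hM x hx
    | succ m ih =>
      intro τ h x _ hh hM hx hm
      have h1 := ih τ h x (Nat.zero_le _) hh hM hx (hconv hx hm m (Nat.le_succ m))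
      have h2 := ih τ h (x + τ) (Nat.zero_le _) hh hM
        (by simpa using hconv hx hm 1 (by omega))
        (by rw [add_assoc, ← succ_nsmul']; exact hm)
      rw [hrec]
      refine (norm_sub_le _ _).trans ?_
      rw [pow_succ]
      linarith
  -- One difference is exchanged for a derivative and a factor `|τ|` by the mean value inequality
  -- between `x` and `x + τ`. The differences left over when `k` is exhausted cost a factor `2`
  -- each.
  | succ k ih =>
    intro m τ h x hkm hh hM hx hm
    obtain ⟨m, rfl⟩ : ∃ m', m = m' + 1 := ⟨m - 1, by omega⟩
    have hM0 : 0 ≤ M := (norm_nonneg _).trans (hM x hx)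
    rw [Nat.cast_succ, contDiffOn_succ_iff_deriv_of_isOpen isOpen_Ioo] at hh
    rw [hrec]
    have hxτ : x + τ ∈ Ioo a b := by simpa using hconv hx hm 1 (by omega)
    have hseg : ∀ y ∈ uIcc x (x + τ), y ∈ Ioo a b ∧ y + m • τ ∈ Ioo a b := by
      intro y hy
      refine ⟨(convex_Ioo a b).ordConnected.uIcc_subset hx hxτ hy, ?_⟩
      have h1 : x + m • τ ∈ Ioo a b := hconv hx hm m (by omega)
      rw [succ_nsmul', ← add_assoc] at hm
      refine (convex_Ioo a b).ordConnected.uIcc_subset h1 hm ?_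
      simpa using (image_add_const_uIcc (m • τ) x (x + τ)).le ⟨y, hy, rfl⟩
    have hder : ∀ y ∈ uIcc x (x + τ),
        HasDerivWithinAt ((fwdDiff τ)^[m] h) ((fwdDiff τ)^[m] (deriv h) y) (uIcc x (x + τ)) y := by
      intro y hy
      refine (hasDerivAt_fwdDiff_iter m τ fun r hr => ?_).hasDerivWithinAt
      exact hh.1.differentiableAt
        (Ioo_mem_nhds (hconv (hseg y hy).1 (hseg y hy).2 r hr).1
          (hconv (hseg y hy).1 (hseg y hy).2 r hr).2)
    have hbd : ∀ y ∈ uIcc x (x + τ), ‖(fwdDiff τ)^[m] (deriv h) y‖ ≤ 2 ^ m * |τ| ^ k * M := by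
      intro y hy
      refine ih m τ (deriv h) y (by omega) hh.2.2 (fun s hs => ?_) (hseg y hy).1 (hseg y hy).2
      rw [← iteratedDeriv_succ']
      exact hM s hs
    have := (convex_uIcc x (x + τ)).norm_image_sub_le_of_norm_hasDerivWithin_le hder hbd
      left_mem_uIcc right_mem_uIcc
    refine this.trans ?_
    rw [add_sub_cancel_left, Real.norm_eq_abs]
    calc 2 ^ m * |τ| ^ k * M * |τ| = 2 ^ m * |τ| ^ (k + 1) * M := by ring
      _ ≤ 2 ^ (m + 1) * |τ| ^ (k + 1) * M := by
        gcongr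
        · norm_num
        · omega

/-- A weighted mean of the values of `h` at `t, 2 t, …, m t`, which extrapolates `h 0` to order
`m`. -/
def extrapolation {F : Type*} [AddCommGroup F] [Module ℂ F] (m : ℕ) (h : ℝ → F) (t : ℝ) : F :=
  ∑ r ∈ Finset.range m, ((-1) ^ r * (m.choose (r + 1) : ℂ)) • h ((r + 1) * t)

/-- The increments of a sequence, starting with its first term. -/
def increments {F : Type*} [AddCommGroup F] (a : ℕ → F) : ℕ → F
  | 0 => a 0
  | j + 1 => a (j + 1) - a j

theorem sum_increments {F : Type*} [AddCommGroup F] (a : ℕ → F) (J : ℕ) :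
    ∑ j ∈ Finset.range (J + 1), increments a j = a J := by
  induction J with
  | zero => simp [increments]
  | succ J ih => rw [Finset.sum_range_succ, ih, increments]; abel

/-- Summation by parts: it trades increments of the operators or kernels for the operators or
kernels themselves, at the price of shifted weights. -/
theorem sum_smul_increments {F : Type*} [AddCommGroup F] [Module ℂ F] (a : ℕ → F) (c : ℕ → ℂ)
    (J : ℕ) : ∑ j ∈ Finset.range (J + 1), c j • increments a j =
      ∑ j ∈ Finset.range (J + 1), c j • a j - ∑ j ∈ Finset.range J, c (j + 1) • a j := by
  rw [Finset.sum_range_succ', Finset.sum_range_succ' (fun j => c j • a j)]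
  simp only [increments, smul_sub, Finset.sum_sub_distrib]
  abel

theorem map_extrapolation {F G : Type*} [AddCommGroup F] [Module ℂ F] [AddCommGroup G] [Module ℂ G]
    (φ : F →ₗ[ℂ] G) (m : ℕ) (h : ℝ → F) (t : ℝ) :
    φ (extrapolation m h t) = extrapolation m (fun v => φ (h v)) t := by
  simp [extrapolation, map_sum]

theorem map_increments {F G : Type*} [AddCommGroup F] [Module ℂ F] [AddCommGroup G] [Module ℂ G]
    (φ : F →ₗ[ℂ] G) (a : ℕ → F) (j : ℕ) :
    φ (increments a j) = increments (fun i => φ (a i)) j := by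
  cases j <;> simp [increments]

theorem sum_choose_succ_le (m : ℕ) : ∑ r ∈ Finset.range m, (m.choose (r + 1) : ℝ) ≤ 2 ^ m := by
  have h := Nat.sum_range_choose m
  rw [Finset.sum_range_succ'] at h
  exact_mod_cast (by omega : ∑ r ∈ Finset.range m, m.choose (r + 1) ≤ 2 ^ m)

theorem norm_extrapolation_coeff (m r : ℕ) :
    ‖((-1) ^ r * (m.choose (r + 1) : ℂ))‖ = m.choose (r + 1) := by
  simp

/-- This is `(1 - 1)^m = 0` without its first term. It makes an extrapolation converge to the common
limit of its nodes. -/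
theorem sum_extrapolation_coeff {m : ℕ} (hm : 0 < m) :
    ∑ r ∈ Finset.range m, ((-1) ^ r * (m.choose (r + 1) : ℂ)) = 1 := by
  have h := Int.alternating_sum_range_choose_of_ne hm.ne'
  rw [Finset.sum_range_succ'] at h
  have h2 : ∑ r ∈ Finset.range m, ((-1) ^ r * (m.choose (r + 1) : ℤ)) = 1 := by
    simp only [pow_succ, mul_neg, mul_one, neg_mul, Finset.sum_neg_distrib, pow_zero,
      Nat.choose_zero_right, Nat.cast_one] at h
    linarith
  exact_mod_cast h2

/-- The extrapolation is the `m`-th difference at `0` with the term `h 0` removed. Its error is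
therefore controlled by a derivative of any order `k ≤ m`, and two different orders are used later.
-/
theorem sub_extrapolation_eq (m : ℕ) (h : ℝ → ℂ) (t : ℝ) :
    h 0 - extrapolation m h t = (-1) ^ m * (fwdDiff t)^[m] h 0 := by
  rw [fwdDiff_iter_eq_sum_shift, Finset.sum_range_succ', extrapolation, mul_add, Finset.mul_sum]
  have h1 : ∀ r ∈ Finset.range m, (-1 : ℂ) ^ m * (((-1 : ℤ) ^ (m - (r + 1)) * (m.choose (r + 1) : ℤ))
      • h (0 + (r + 1) • t)) = -(((-1) ^ r * (m.choose (r + 1) : ℂ)) • h ((r + 1) * t)) := by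
    intro r hr
    have hr' : r + 1 ≤ m := Finset.mem_range.1 hr
    obtain ⟨d, rfl⟩ := Nat.exists_eq_add_of_le hr'
    have h3 : ((-1 : ℂ)) ^ d * (-1) ^ d = 1 := by rw [← mul_pow]; simp
    have h4 : (0 : ℝ) + (r + 1) • t = (r + 1) * t := by simp
    rw [h4, Nat.add_sub_cancel_left, zsmul_eq_mul, smul_eq_mul]
    push_cast
    rw [pow_add, pow_succ]
    linear_combination (-((-1 : ℂ)) ^ r * ((r + 1 + d).choose (r + 1) : ℂ) * h ((r + 1) * t)) * h3
  rw [Finset.sum_congr rfl h1]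
  have h3 : ((-1 : ℂ)) ^ m * (-1) ^ m = 1 := by rw [← mul_pow]; simp
  simp only [Finset.sum_neg_distrib, Nat.sub_zero, Nat.choose_zero_right, zsmul_eq_mul,
    zero_smul, add_zero]
  push_cast
  linear_combination -(h 0) * h3

/-- A two-sided geometric sum is bounded independently of its centre. -/
theorem sum_min_geom_le {ρ V : ℝ} (hρ : 1 < ρ) (hV : 0 < V) (J : ℕ) :
    ∑ j ∈ Finset.range J, min (ρ ^ j / V) (V / ρ ^ j) ≤ 4 * ρ / (ρ - 1) := by
  -- `ψ` increases from `0` to `1`, and `ψ (ρ y) - ψ y` dominates a multiple of `min y y⁻¹`. The sum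
  -- thus telescopes, wherever `V` lies among the powers of `ρ`.
  set ψ : ℝ → ℝ := fun y => y / (1 + y)
  have hρ1 : 0 < ρ - 1 := by linarith
  have key : ∀ y : ℝ, 0 < y → min y y⁻¹ ≤ 4 * ρ / (ρ - 1) * (ψ (ρ * y) - ψ y) := by
    intro y hy
    have hρ0 : 0 < ρ := by linarith
    have e : 4 * ρ / (ρ - 1) * (ψ (ρ * y) - ψ y) = 4 * ρ * y / ((1 + ρ * y) * (1 + y)) := by
      simp only [ψ]
      field_simp
      ring
    rw [e]
    rcases le_total y 1 with h | h
    · refine (min_le_left _ _).trans ?_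
      rw [le_div_iff₀ (by positivity)]
      have : (1 + ρ * y) * (1 + y) ≤ (2 * ρ) * 2 := by
        gcongr
        · nlinarith
        · linarith
      nlinarith
    · refine (min_le_right _ _).trans ?_
      rw [inv_eq_one_div, div_le_div_iff₀ hy (by positivity)]
      have : (1 + ρ * y) * (1 + y) ≤ (2 * (ρ * y)) * (2 * y) := by
        gcongr
        · nlinarith
        · linarith
      nlinarith
  calc _ ≤ ∑ j ∈ Finset.range J, 4 * ρ / (ρ - 1) *
        (ψ (ρ ^ (j + 1) / V) - ψ (ρ ^ j / V)) := by
        refine Finset.sum_le_sum fun j _ => ?_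
        have := key (ρ ^ j / V) (by positivity)
        rw [inv_div] at this
        rwa [mul_div_assoc', ← pow_succ'] at this
    _ = 4 * ρ / (ρ - 1) * (ψ (ρ ^ J / V) - ψ (ρ ^ 0 / V)) := by
        rw [← Finset.mul_sum, Finset.sum_range_sub (fun j => ψ (ρ ^ j / V))]
    _ ≤ 4 * ρ / (ρ - 1) * 1 := by
        have h0 : 0 < ρ ^ J / V := by positivity
        have h1 : ψ (ρ ^ J / V) ≤ 1 := by
          simp only [ψ]
          rw [div_le_one (by positivity)]
          linarith
        have h2 : 0 ≤ ψ (ρ ^ 0 / V) := by simp only [ψ]; positivity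
        gcongr
        linarith
    _ = _ := mul_one _

end FiniteDifferences

/-! ### Pointwise bounds for weighted dyadic sums of kernels, uniform in `w`. -/

section KernelBounds

/-- The weights `2^(b j)` cancel the decay of the errors `h0 - a j` exactly, which leaves the
two-sided geometric series. Summation by parts uses it twice, the second time with weights shifted
by one index, whence the factor `2^b`. -/
theorem norm_sum_mul_increments_le {a : ℕ → ℂ} {h0 : ℂ} {A b V ρ : ℝ} (hρ : 1 < ρ) (hV : 0 < V)
    (hh0 : ‖h0‖ ≤ A)
    (he : ∀ j : ℕ, ‖h0 - a j‖ ≤ A * ((2 : ℝ) ^ (-(b * j)) * min (ρ ^ j / V) (V / ρ ^ j)))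
    {c : ℕ → ℂ} (hc : ∀ j : ℕ, ‖c j‖ ≤ (2 : ℝ) ^ (b * j)) (J : ℕ) :
    ‖∑ j ∈ Finset.range (J + 1), c j * increments a j‖
      ≤ A * (1 + (1 + (2 : ℝ) ^ b) * (4 * ρ / (ρ - 1))) := by
  have hA : 0 ≤ A := (norm_nonneg _).trans hh0
  set e : ℕ → ℂ := fun j => h0 - a j
  have hmin : ∀ j, 0 ≤ min (ρ ^ j / V) (V / ρ ^ j) := fun j => by
    have : 0 < ρ := by linarith
    positivity
  -- Increments of `a` are minus those of the errors, except the first, which is `a 0` itself; this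
  -- leaves the term `c 0 * h0`.
  have h1 : ∑ j ∈ Finset.range (J + 1), c j * increments a j =
      c 0 * h0 - ∑ j ∈ Finset.range (J + 1), c j • increments e j := by
    rw [Finset.sum_range_succ', Finset.sum_range_succ']
    simp only [increments, e, smul_eq_mul]
    have : ∀ j, c (j + 1) * (h0 - a (j + 1) - (h0 - a j)) = -(c (j + 1) * (a (j + 1) - a j)) :=
      fun j => by ring
    simp only [this, Finset.sum_neg_distrib]
    ring
  have hK := sum_min_geom_le hρ hV
  have h2 : ‖∑ j ∈ Finset.range (J + 1), c j • e j‖ ≤ A * (4 * ρ / (ρ - 1)) := by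
    refine (norm_sum_le _ _).trans ?_
    calc _ ≤ ∑ j ∈ Finset.range (J + 1), A * min (ρ ^ j / V) (V / ρ ^ j) := by
          refine Finset.sum_le_sum fun j _ => ?_
          rw [norm_smul]
          calc ‖c j‖ * ‖e j‖ ≤ (2 : ℝ) ^ (b * j) *
                (A * ((2 : ℝ) ^ (-(b * j)) * min (ρ ^ j / V) (V / ρ ^ j))) := by
                gcongr
                · exact hc j
                · exact he j
            _ = ((2 : ℝ) ^ (b * j) * (2 : ℝ) ^ (-(b * j))) * (A * min (ρ ^ j / V) (V / ρ ^ j)) := by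
                ring
            _ = _ := by rw [← Real.rpow_add two_pos]; simp
      _ ≤ _ := by
          rw [← Finset.mul_sum]
          gcongr
          exact hK _
  have h3 : ‖∑ j ∈ Finset.range J, c (j + 1) • e j‖ ≤ A * ((2 : ℝ) ^ b * (4 * ρ / (ρ - 1))) := by
    refine (norm_sum_le _ _).trans ?_
    calc _ ≤ ∑ j ∈ Finset.range J, A * ((2 : ℝ) ^ b * min (ρ ^ j / V) (V / ρ ^ j)) := by
          refine Finset.sum_le_sum fun j _ => ?_
          rw [norm_smul]
          calc ‖c (j + 1)‖ * ‖e j‖ ≤ (2 : ℝ) ^ (b * (j + 1 : ℕ)) *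
                (A * ((2 : ℝ) ^ (-(b * j)) * min (ρ ^ j / V) (V / ρ ^ j))) := by
                gcongr
                · exact hc (j + 1)
                · exact he j
            _ = ((2 : ℝ) ^ (b * (j + 1 : ℕ)) * (2 : ℝ) ^ (-(b * j))) *
                  (A * min (ρ ^ j / V) (V / ρ ^ j)) := by
                ring
            _ = _ := by
                rw [← Real.rpow_add two_pos,
                  show b * ((j + 1 : ℕ) : ℝ) + -(b * j) = b by push_cast; ring]
                ring
      _ ≤ _ := by
          rw [← Finset.mul_sum, ← Finset.mul_sum]
          gcongr
          exact hK _
  rw [h1, sum_smul_increments]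
  have hc0 : ‖c 0 * h0‖ ≤ A := by
    have := hc 0
    simp only [CharP.cast_eq_zero, mul_zero, Real.rpow_zero] at this
    rw [norm_mul]
    nlinarith [norm_nonneg (c 0), norm_nonneg h0]
  calc _ ≤ ‖c 0 * h0‖ + (‖∑ j ∈ Finset.range (J + 1), c j • e j‖ +
        ‖∑ j ∈ Finset.range J, c (j + 1) • e j‖) :=
        (norm_sub_le _ _).trans (add_le_add le_rfl (norm_sub_le _ _))
    _ ≤ A + (A * (4 * ρ / (ρ - 1)) + A * ((2 : ℝ) ^ b * (4 * ρ / (ρ - 1)))) := by gcongr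
    _ = _ := by ring

/-- Used to freeze `s` at `lam` in the kernel estimates; the exponent may have either sign. -/
theorem rpow_le_two_pow_mul_rpow {x y e : ℝ} {n : ℕ} (hy : 0 < y) (h1 : y ≤ 2 * x)
    (h2 : x ≤ 2 * y) (he : |e| ≤ n) : x ^ e ≤ 2 ^ n * y ^ e := by
  have hx : 0 < x := by linarith
  have h3 : x ^ e = (x / y) ^ e * y ^ e := by
    rw [Real.div_rpow hx.le hy.le]
    field_simp
  rw [h3]
  gcongr
  have hr : 0 < x / y := by positivity
  have key : (x / y) ^ e ≤ (2 : ℝ) ^ |e| := by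
    rcases le_total 0 e with h | h
    · rw [abs_of_nonneg h]
      exact Real.rpow_le_rpow hr.le (by rw [div_le_iff₀ hy]; exact h2) h
    · rw [abs_of_nonpos h, ← inv_inv (x / y), Real.inv_rpow (by positivity),
        ← Real.rpow_neg (by positivity)]
      refine Real.rpow_le_rpow (by positivity) ?_ (by linarith)
      rw [inv_div, div_le_iff₀ hx]
      exact h1
  calc _ ≤ (2 : ℝ) ^ |e| := key
    _ ≤ (2 : ℝ) ^ (n : ℝ) := Real.rpow_le_rpow_of_exponent_le one_le_two he
    _ = _ := Real.rpow_natCast _ _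

/-- The gain `⌊(n + 1) / 2⌋ - (n - 1) / 2 > 0` of the highest derivative in the kernel estimates. -/
noncomputable def kernelGain (n : ℕ) : ℝ := ((n + 1) / 2 : ℕ) - ((n : ℝ) - 1) / 2

theorem kernelGain_pos (n : ℕ) : 0 < kernelGain n := by
  unfold kernelGain
  have : n + 1 < 2 * ((n + 1) / 2) + 2 := by omega
  have h2 : ((n : ℝ) + 1) < 2 * ((n + 1) / 2 : ℕ) + 2 := by exact_mod_cast this
  have h3 : (n : ℝ) ≤ 2 * ((n + 1) / 2 : ℕ) := by exact_mod_cast (by omega : n ≤ 2 * ((n + 1) / 2))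
  linarith

/-- The constant in `norm_sum_mul_increments_extrapolation_le`. -/
noncomputable def kernelConst (n : ℕ) : ℝ :=
  2 ^ n * 4 ^ n * (1 + (1 + (2 : ℝ) ^ (((n : ℝ) - 1) / 2)) *
    (4 * (2 : ℝ) ^ kernelGain n / ((2 : ℝ) ^ kernelGain n - 1)))

theorem one_lt_two_rpow_kernelGain (n : ℕ) : 1 < (2 : ℝ) ^ kernelGain n :=
  Real.one_lt_rpow one_lt_two (kernelGain_pos n)

/-- The weighted dyadic sum of the increments of the extrapolations of a kernel satisfying the
spectral measure estimates is bounded, uniformly with respect to the weight `w`. -/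
theorem norm_sum_mul_increments_extrapolation_le {n : ℕ} (hn : 2 ≤ n) {δ lam C w : ℝ}
    (hδ : 0 < δ) (hδ1 : δ < 1) (hlam : 0 < lam) (hw : 0 ≤ w) {h : ℝ → ℂ}
    (hh : ContDiffOn ℝ ((n + 1) / 2 : ℕ) h (Ioo ((1 - δ) * lam) ((1 + δ) * lam)))
    (hbd : ∀ k ≤ (n + 1) / 2, ∀ s ∈ Ioo ((1 - δ) * lam) ((1 + δ) * lam),
      ‖iteratedDeriv k h s‖ ≤
        C * s ^ ((n : ℝ) - 1 - k) * (1 + s * w) ^ (-((n : ℝ) - 1) / 2 + k))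
    {c : ℕ → ℂ} (hc : ∀ j : ℕ, ‖c j‖ ≤ (2 : ℝ) ^ (((n : ℝ) - 1) / 2 * j)) (J : ℕ)
    {θ t : ℝ} (hθ : 0 ≤ θ) (hθ2 : θ ≤ 2) (ht : 0 ≤ t) (ht1 : 2 * t ≤ 1)
    (htδ : 4 * (((n + 1) / 2 : ℕ) * t) < δ) :
    ‖∑ j ∈ Finset.range (J + 1), c j * increments (fun j =>
      extrapolation ((n + 1) / 2) (fun v => h (lam - lam * v)) (t / 2 ^ j * θ)) j‖
      ≤ kernelConst n * (C * lam ^ ((n : ℝ) - 1)) := by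
  set m := (n + 1) / 2 with hm
  set β : ℝ := ((n : ℝ) - 1) / 2 with hβ
  have hn2 : (2 : ℝ) ≤ n := by exact_mod_cast hn
  have hmn : (m : ℝ) ≤ n - 1 := by
    have : m + 1 ≤ n := by omega
    have : (m : ℝ) + 1 ≤ n := by exact_mod_cast this
    linarith
  have hlamI : lam ∈ Ioo ((1 - δ) * lam) ((1 + δ) * lam) := by constructor <;> nlinarith
  have hC : 0 ≤ C := by
    have h1 := (norm_nonneg _).trans (hbd 0 (Nat.zero_le _) lam hlamI)
    by_contra hneg
    have h2 : 0 < lam ^ ((n : ℝ) - 1 - (0 : ℕ)) * (1 + lam * w) ^ (-((n : ℝ) - 1) / 2 + (0 : ℕ)) := by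
      positivity
    rw [mul_assoc] at h1
    nlinarith
  set W : ℝ := 1 + lam * w with hW
  have hW1 : 1 ≤ W := by have := mul_nonneg hlam.le hw; linarith
  have hW0 : 0 < W := by linarith
  set I := Ioo ((1 - δ / 2) * lam) ((1 + δ / 2) * lam) with hI
  have hII : I ⊆ Ioo ((1 - δ) * lam) ((1 + δ) * lam) := by
    apply Ioo_subset_Ioo <;> nlinarith
  set A : ℝ := 4 ^ n * (C * lam ^ ((n : ℝ) - 1)) with hA
  have hA0 : 0 ≤ A := by positivity
  -- On the half-width interval `I`, both `s / lam` and `(1 + s w) / W` lie between `1/2` and `2`.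
  -- Freezing them costs `2 ^ n` each, hence the `4 ^ n` in `A`.
  have hbd' : ∀ k ≤ m, ∀ s ∈ I, ‖iteratedDeriv k h s‖ ≤ A * lam ^ (-(k : ℝ)) * W ^ ((k : ℝ) - β) := by
    intro k hk s hs
    have hk' : (k : ℝ) ≤ m := by exact_mod_cast hk
    have hk0 : (0 : ℝ) ≤ k := by positivity
    have hs1 : lam ≤ 2 * s := by have := hs.1; nlinarith
    have hs2 : s ≤ 2 * lam := by have := hs.2; nlinarith
    have hs0 : 0 < s := by linarith
    have e1 : s ^ ((n : ℝ) - 1 - k) ≤ 2 ^ n * lam ^ ((n : ℝ) - 1 - k) := by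
      refine rpow_le_two_pow_mul_rpow hlam hs1 hs2 ?_
      rw [abs_le]
      constructor <;> linarith
    have e2 : (1 + s * w) ^ (-((n : ℝ) - 1) / 2 + k) ≤ 2 ^ n * W ^ (-((n : ℝ) - 1) / 2 + k) := by
      refine rpow_le_two_pow_mul_rpow hW0 ?_ ?_ ?_
      · nlinarith
      · nlinarith
      · rw [abs_le]
        constructor <;> linarith
    calc _ ≤ C * s ^ ((n : ℝ) - 1 - k) * (1 + s * w) ^ (-((n : ℝ) - 1) / 2 + k) :=
          hbd k hk s (hII hs)
      _ ≤ C * (2 ^ n * lam ^ ((n : ℝ) - 1 - k)) * (2 ^ n * W ^ (-((n : ℝ) - 1) / 2 + k)) := by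
          gcongr
      _ = _ := by
          rw [sub_eq_add_neg ((n : ℝ) - 1) (k : ℝ), Real.rpow_add hlam,
            show -((n : ℝ) - 1) / 2 + k = k - β by rw [hβ]; ring, hA,
            show (4 : ℝ) = 2 * 2 by norm_num, mul_pow]
          ring
  -- A difference with step `lam τ`, `τ ≤ 2^(-j)`, gains `(lam 2^(-j))^k` from the derivative of
  -- order `k`. The powers of `lam` cancel, and `2^(-jk) W^(k-β)` is written as the fixed decay
  -- `2^(-βj)` times a power of `W / 2^j`.
  have hdiff : ∀ k ≤ m, ∀ j : ℕ, ‖h lam - extrapolation m (fun v => h (lam - lam * v)) (t / 2 ^ j * θ)‖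
      ≤ 2 ^ m * A * ((2 : ℝ) ^ (-(β * j)) * (W / 2 ^ j) ^ ((k : ℝ) - β)) := by
    intro k hk j
    have hτ0 : 0 ≤ t / 2 ^ j * θ := by positivity
    have hτ2 : t / 2 ^ j * θ ≤ 2 * t / 2 ^ j := by
      calc t / 2 ^ j * θ ≤ t / 2 ^ j * 2 := by gcongr
        _ = _ := by ring
    have h2j : (1 : ℝ) ≤ 2 ^ j := one_le_pow₀ one_le_two
    have hτ1 : t / 2 ^ j * θ ≤ 1 / 2 ^ j := hτ2.trans (by gcongr)
    have hτ3 : t / 2 ^ j * θ ≤ 2 * t := hτ2.trans (div_le_self (by positivity) h2j)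
    generalize t / 2 ^ j * θ = τ at *
    have e1 := sub_extrapolation_eq m (fun v => h (lam - lam * v)) τ
    simp only [mul_zero, sub_zero] at e1
    have e2 : (fwdDiff τ)^[m] (fun v => h (lam - lam * v)) 0 = (fwdDiff (-(lam * τ)))^[m] h lam := by
      rw [fwdDiff_iter_eq_sum_shift, fwdDiff_iter_eq_sum_shift]
      refine Finset.sum_congr rfl fun r _ => ?_
      congr 2
      simp only [nsmul_eq_mul]
      ring
    rw [e1, e2, norm_mul, norm_pow, norm_neg, norm_one, one_pow, one_mul]
    have hm0 : (0 : ℝ) ≤ m := by positivity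
    have hmτ : (m : ℝ) * τ ≤ δ / 2 - 0 ∧ (m : ℝ) * τ < δ / 2 := by
      have : (m : ℝ) * τ ≤ m * (2 * t) := by gcongr
      constructor <;> linarith
    have hmem : lam + m • (-(lam * τ)) ∈ I := by
      rw [hI, nsmul_eq_mul, mem_Ioo]
      have : 0 ≤ lam * (m * τ) := by positivity
      constructor <;> nlinarith
    have hmem0 : lam ∈ I := by rw [hI, mem_Ioo]; constructor <;> nlinarith
    refine (norm_fwdDiff_iter_le k m _ h lam hk
      ((hh.of_le (by exact_mod_cast hk)).mono hII) (hbd' k hk) hmem0 hmem).trans ?_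
    rw [abs_neg, abs_of_nonneg (by positivity)]
    have hτk : τ ^ k ≤ (1 / 2 ^ j) ^ k := by gcongr
    calc 2 ^ m * (lam * τ) ^ k * (A * lam ^ (-(k : ℝ)) * W ^ ((k : ℝ) - β))
        = 2 ^ m * A * (τ ^ k * W ^ ((k : ℝ) - β)) * (lam ^ k * lam ^ (-(k : ℝ))) := by
          rw [mul_pow]; ring
      _ = 2 ^ m * A * (τ ^ k * W ^ ((k : ℝ) - β)) := by
          rw [Real.rpow_neg hlam.le, Real.rpow_natCast, mul_inv_cancel₀ (by positivity), mul_one]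
      _ ≤ 2 ^ m * A * ((1 / 2 ^ j) ^ k * W ^ ((k : ℝ) - β)) := by gcongr
      _ = _ := by
          have q1 : ((1 : ℝ) / 2 ^ j) ^ k = (2 : ℝ) ^ (-((j : ℝ) * k)) := by
            rw [one_div, inv_pow, ← pow_mul, Real.rpow_neg two_pos.le, ← Nat.cast_mul,
              Real.rpow_natCast]
          have q2 : (W / 2 ^ j) ^ ((k : ℝ) - β) =
              W ^ ((k : ℝ) - β) * (2 : ℝ) ^ (-((j : ℝ) * (k - β))) := by
            rw [Real.div_rpow hW0.le (by positivity), ← Real.rpow_natCast 2 j,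
              ← Real.rpow_mul two_pos.le, Real.rpow_neg two_pos.le, div_eq_mul_inv]
          rw [q1, q2, show -((j : ℝ) * k) = -(β * j) + -((j : ℝ) * (k - β)) by ring,
            Real.rpow_add two_pos]
          ring
  have hρ := one_lt_two_rpow_kernelGain n
  have hσ : kernelGain n = m - β := rfl
  have hAA : A ≤ 2 ^ m * A := le_mul_of_one_le_left hA0 (one_le_pow₀ one_le_two)
  have hmain := norm_sum_mul_increments_le (h0 := h lam) (A := 2 ^ m * A) (b := β)
    (V := W ^ kernelGain n) (a := fun j =>
      extrapolation m (fun v => h (lam - lam * v)) (t / 2 ^ j * θ)) hρ (by positivity)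
      ?_ ?_ hc J
  · refine hmain.trans ?_
    have : (2 : ℝ) ^ m ≤ 2 ^ n := pow_le_pow_right₀ one_le_two (by omega)
    have h0 : 0 < (2 : ℝ) ^ kernelGain n - 1 := by linarith
    unfold kernelConst
    rw [hA, ← hβ]
    calc _ ≤ 2 ^ n * (4 ^ n * (C * lam ^ ((n : ℝ) - 1))) * (1 + (1 + (2 : ℝ) ^ β) *
          (4 * (2 : ℝ) ^ kernelGain n / ((2 : ℝ) ^ kernelGain n - 1))) := by gcongr
      _ = _ := by ring
  · have h1 := hbd' 0 (Nat.zero_le _) lam (by rw [hI, mem_Ioo]; constructor <;> nlinarith)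
    simp only [iteratedDeriv_zero, Nat.cast_zero, neg_zero, Real.rpow_zero, mul_one, zero_sub] at h1
    refine h1.trans ((mul_le_of_le_one_right hA0 ?_).trans hAA)
    exact Real.rpow_le_one_of_one_le_of_nonpos hW1 (by rw [hβ]; linarith)
  · intro j
    have hr : ((2 : ℝ) ^ kernelGain n) ^ j = ((2 : ℝ) ^ j) ^ kernelGain n := by
      rw [← Real.rpow_natCast, ← Real.rpow_natCast, ← Real.rpow_mul two_pos.le,
        ← Real.rpow_mul two_pos.le, mul_comm]
    rw [hr, ← Real.div_rpow hW0.le (by positivity), ← Real.div_rpow (by positivity) hW0.le]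
    -- Order `m` gives the exponent `m - β = σ`. Order `n - 1 - m` gives `n - 1 - m - β = -σ`
    -- because `2β = n - 1`; this order is a natural number only because `n ≥ 2`.
    rcases min_choice ((2 ^ j / W) ^ kernelGain n) ((W / 2 ^ j) ^ kernelGain n) with hmin | hmin
    · rw [hmin]
      have hk1 : ((n - 1 - m : ℕ) : ℝ) = n - 1 - m := by
        rw [Nat.sub_sub, Nat.cast_sub (by omega)]
        push_cast
        ring
      have := hdiff (n - 1 - m) (by omega) j
      have hinv : (W / 2 ^ j) ^ (-kernelGain n) = (2 ^ j / W) ^ kernelGain n := by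
        rw [Real.rpow_neg (by positivity), ← Real.inv_rpow (by positivity), inv_div]
      rwa [hk1, show (n : ℝ) - 1 - m - β = -kernelGain n by rw [hσ, hβ]; ring, hinv] at this
    · rw [hmin, hσ]
      exact hdiff m le_rfl j

end KernelBounds

/-! ### The two endpoint bounds for weighted sums of spectral multipliers. -/

section Multipliers

/-- The mean value of the derivative of `b` over `[lam - 2 v lam, lam - v lam]`. -/
noncomputable def meanDeriv {F : Type*} [AddCommGroup F] [Module ℂ F] (b : ℝ → F) (lam v : ℝ) : F :=
  ((v * lam : ℝ) : ℂ)⁻¹ • (b (lam - lam * v) - b (lam - lam * (v * 2)))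

theorem map_meanDeriv {F G : Type*} [AddCommGroup F] [Module ℂ F] [AddCommGroup G] [Module ℂ G]
    (φ : F →ₗ[ℂ] G) (b : ℝ → F) (lam v : ℝ) :
    φ (meanDeriv b lam v) = meanDeriv (fun s => φ (b s)) lam v := by
  simp [meanDeriv]

/-- For each fixed node `r + 1`, the intervals of the mean derivatives at the scales `t / 2^j` are
adjacent, so the spectral increments are orthogonal. The weight `2^(-j)` compensates the
normalization `2^j / (t lam)`, and the binomial coefficients sum to at most `2 ^ m`. -/
theorem IsProjectionFamily.norm_sum_mul_extrapolation_le {H : Type*} [NormedAddCommGroup H]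
    [InnerProductSpace ℂ H] [CompleteSpace H] {E : ℝ → H →L[ℂ] H} (hE : IsProjectionFamily E)
    (m : ℕ) {lam t : ℝ} (hlam : 0 < lam) (ht : 0 < t) {c : ℕ → ℂ}
    (hc : ∀ j, ‖c j‖ ≤ (1 / 2) ^ j) (J : ℕ) (f g : H) :
    ‖∑ j ∈ Finset.range J, c j *
      extrapolation m (meanDeriv (fun s => inner ℂ g (E s f)) lam) (t / 2 ^ j)‖
      ≤ 2 ^ m * ((t * lam)⁻¹ * (‖f‖ * ‖g‖)) := by
  have h1 : ∑ j ∈ Finset.range J, c j *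
      extrapolation m (meanDeriv (fun s => inner ℂ g (E s f)) lam) (t / 2 ^ j) =
      ∑ r ∈ Finset.range m, ((-1) ^ r * (m.choose (r + 1) : ℂ)) *
        ∑ j ∈ Finset.range J, (c j * ((((r + 1) * (t / 2 ^ j)) * lam : ℝ) : ℂ)⁻¹) *
          inner ℂ g ((E (lam - lam * ((r + 1) * (t / 2 ^ (j + 1)) * 2)) -
            E (lam - lam * ((r + 1) * (t / 2 ^ j) * 2))) f) := by
    simp only [extrapolation, Finset.mul_sum]
    rw [Finset.sum_comm]
    refine Finset.sum_congr rfl fun r _ => Finset.sum_congr rfl fun j _ => ?_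
    -- The left end of the interval at scale `j + 1` is the right end of the one at scale `j`.
    have : lam - lam * ((r + 1) * (t / 2 ^ (j + 1)) * 2) = lam - lam * ((r + 1) * (t / 2 ^ j)) := by
      rw [pow_succ]
      field_simp
    rw [this, meanDeriv, sub_apply, inner_sub_right]
    simp only [smul_eq_mul]
    ring
  rw [h1]
  calc _ ≤ ∑ r ∈ Finset.range m, (m.choose (r + 1) : ℝ) * ((t * lam)⁻¹ * (‖f‖ * ‖g‖)) := by
        refine (norm_sum_le _ _).trans (Finset.sum_le_sum fun r _ => ?_)
        rw [norm_mul, norm_extrapolation_coeff]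
        gcongr
        refine hE.norm_sum_mul_inner_le
          (s := fun j => lam - lam * ((r + 1) * (t / 2 ^ j) * 2)) ?_ ?_ f g
        · refine monotone_nat_of_le_succ fun j => ?_
          have : t / 2 ^ (j + 1) ≤ t / 2 ^ j := by
            gcongr
            · norm_num
            · omega
          gcongr
        · intro j
          rw [norm_mul, norm_inv, Complex.norm_real, Real.norm_of_nonneg (by positivity)]
          have e : (((r : ℝ) + 1) * (t / 2 ^ j) * lam)⁻¹ = 2 ^ j * (((r : ℝ) + 1)⁻¹ * (t * lam)⁻¹) := by
            field_simp
          rw [e]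
          calc ‖c j‖ * (2 ^ j * (((r : ℝ) + 1)⁻¹ * (t * lam)⁻¹))
              ≤ (1 / 2) ^ j * (2 ^ j * (1 * (t * lam)⁻¹)) := by
                gcongr
                · exact hc j
                · exact inv_le_one_of_one_le₀ (by linarith [(Nat.cast_nonneg r : (0 : ℝ) ≤ r)])
            _ = (t * lam)⁻¹ := by
                rw [← mul_assoc, ← mul_pow]; norm_num
    _ ≤ _ := by
        rw [← Finset.sum_mul]
        have := sum_choose_succ_le m
        gcongr

/-- The `L²` bound for the weighted dyadic sum of spectral multipliers. -/
theorem IsProjectionFamily.norm_sum_mul_increments_le {H : Type*} [NormedAddCommGroup H]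
    [InnerProductSpace ℂ H] [CompleteSpace H] {E : ℝ → H →L[ℂ] H} (hE : IsProjectionFamily E)
    (m : ℕ) {lam t : ℝ} (hlam : 0 < lam) (ht : 0 < t) {c : ℕ → ℂ}
    (hc : ∀ j, ‖c j‖ ≤ (1 / 2) ^ j) (J : ℕ) (f g : H) :
    ‖∑ j ∈ Finset.range (J + 1), c j * increments (fun j =>
      extrapolation m (meanDeriv (fun s => inner ℂ g (E s f)) lam) (t / 2 ^ j)) j‖
      ≤ 2 ^ (m + 1) * ((t * lam)⁻¹ * (‖f‖ * ‖g‖)) := by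
  have h := sum_smul_increments (fun j =>
      extrapolation m (meanDeriv (fun s => inner ℂ g (E s f)) lam) (t / 2 ^ j)) c J
  simp only [smul_eq_mul] at h
  rw [h]
  refine (norm_sub_le _ _).trans ?_
  have h1 := hE.norm_sum_mul_extrapolation_le m hlam ht hc (J + 1) f g
  have h2 := hE.norm_sum_mul_extrapolation_le m hlam ht (c := fun j => c (j + 1))
    (fun j => (hc (j + 1)).trans (pow_le_pow_of_le_one (by norm_num) (by norm_num) (by omega)))
    J f g
  rw [pow_succ]
  linarith

section Integrals

variable {Y : Type*} [MeasurableSpace Y] {ν : Measure Y}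

theorem integral_extrapolation {m : ℕ} {u : ℝ → Y → ℂ} {t : ℝ}
    (hu : ∀ r < m, Integrable (u ((r + 1) * t)) ν) :
    Integrable (fun y => extrapolation m (fun v => u v y) t) ν ∧
    ∫ y, extrapolation m (fun v => u v y) t ∂ν = extrapolation m (fun v => ∫ y, u v y ∂ν) t := by
  have h : ∀ r ∈ Finset.range m, Integrable
      (fun y => ((-1) ^ r * (m.choose (r + 1) : ℂ)) • u ((r + 1) * t) y) ν := fun r hr =>
    (hu r (Finset.mem_range.1 hr)).const_mul _
  refine ⟨integrable_finsetSum _ h, ?_⟩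
  simp only [extrapolation]
  rw [integral_finsetSum _ h]
  exact Finset.sum_congr rfl fun r _ => integral_smul _ _

theorem integral_increments {a : ℕ → Y → ℂ} (ha : ∀ j, Integrable (a j) ν) (j : ℕ) :
    Integrable (fun y => increments (fun i => a i y) j) ν ∧
    ∫ y, increments (fun i => a i y) j ∂ν = increments (fun i => ∫ y, a i y ∂ν) j := by
  cases j with
  | zero => exact ⟨ha 0, rfl⟩
  | succ j => exact ⟨(ha (j + 1)).sub (ha j), integral_sub (ha (j + 1)) (ha j)⟩

theorem hasDerivAt_increments {a : ℕ → ℝ → ℂ} {a' : ℕ → ℂ} {θ : ℝ}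
    (ha : ∀ j, HasDerivAt (a j) (a' j) θ) (j : ℕ) :
    HasDerivAt (fun θ => increments (fun i => a i θ) j) (increments a' j) θ := by
  cases j with
  | zero => exact ha 0
  | succ j => exact (ha (j + 1)).sub (ha j)

theorem extrapolation_mul_right (m : ℕ) (h : ℝ → ℂ) (t : ℝ) (z : ℂ) :
    extrapolation m (fun v => h v * z) t = extrapolation m h t * z := by
  simp [extrapolation, Finset.sum_mul, mul_assoc]

theorem increments_mul_right (a : ℕ → ℂ) (z : ℂ) (j : ℕ) :
    increments (fun i => a i * z) j = increments a j * z := by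
  cases j <;> simp [increments, sub_mul]

/-- The `L¹ → L^∞` bound for the weighted dyadic sum of spectral multipliers: it follows from a
pointwise bound for the kernels, by the mean value inequality. -/
theorem norm_sum_mul_increments_meanDeriv_le {κ : ℝ → Y → ℂ} {F : Y → ℂ} {I : Set ℝ}
    {b : ℝ → ℂ} (hint : ∀ s ∈ I, Integrable (fun y => κ s y * F y) ν) (hF : Integrable F ν)
    (hb : ∀ s ∈ I, HasDerivAt b (∫ y, κ s y * F y ∂ν) s) {m : ℕ} {lam t : ℝ} (hlam : 0 < lam)
    (ht : 0 < t) (hI : ∀ v, 0 ≤ v → v ≤ 2 * (m * t) → lam - lam * v ∈ I) (c : ℕ → ℂ) (J : ℕ) {K : ℝ}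
    (hK : ∀ᵐ y ∂ν, ∀ θ ∈ Icc (1 : ℝ) 2, ‖∑ j ∈ Finset.range (J + 1), c j * increments (fun j =>
      extrapolation m (fun v => κ (lam - lam * v) y) (t / 2 ^ j * θ)) j‖ ≤ K) :
    ‖∑ j ∈ Finset.range (J + 1), c j * increments (fun j =>
      extrapolation m (meanDeriv b lam) (t / 2 ^ j)) j‖ ≤ K * ∫ y, ‖F y‖ ∂ν := by
  -- Formally the mean derivative is the integral over `θ ∈ [1, 2]` of `b'(lam - lam v θ)`. As only
  -- differentiability of `b` is assumed, it is written as `y j 2 - y j 1`, and the weighted sum is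
  -- treated by the mean value inequality in `θ`.
  set y : ℕ → ℝ → ℂ := fun j θ =>
    extrapolation m (fun v => (-((v * lam : ℝ) : ℂ)⁻¹) • b (lam - lam * (v * θ))) (t / 2 ^ j) with hy
  set Y' : ℝ → ℂ := fun θ => ∑ j ∈ Finset.range (J + 1), c j * increments (fun j =>
    extrapolation m (fun v => ∫ y, κ (lam - lam * v) y * F y ∂ν) (t / 2 ^ j * θ)) j with hY'
  have hmem : ∀ j : ℕ, ∀ θ ∈ Icc (1 : ℝ) 2, ∀ r < m,
      lam - lam * ((r + 1) * (t / 2 ^ j * θ)) ∈ I := by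
    intro j θ hθ r hr
    have hθ0 : 0 ≤ θ := by linarith [hθ.1]
    have hr' : (r : ℝ) + 1 ≤ m := by exact_mod_cast hr
    have h2j : (1 : ℝ) ≤ 2 ^ j := one_le_pow₀ one_le_two
    refine hI _ (by positivity) ?_
    have h1 : t / 2 ^ j ≤ t := div_le_self ht.le h2j
    calc ((r : ℝ) + 1) * (t / 2 ^ j * θ) ≤ m * (t * 2) := by
          gcongr
          exact hθ.2
      _ = _ := by ring
  have hder : ∀ θ ∈ Icc (1 : ℝ) 2, HasDerivAt
      (fun θ => ∑ j ∈ Finset.range (J + 1), c j * increments (fun j => y j θ) j) (Y' θ) θ := by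
    intro θ hθ
    refine HasDerivAt.fun_sum fun j _ => HasDerivAt.const_mul _ ?_
    refine hasDerivAt_increments (fun j => ?_) j
    refine HasDerivAt.fun_sum fun r hr => ?_
    simp only [smul_eq_mul]
    refine HasDerivAt.const_mul _ ?_
    have h1 := hb _ (hmem j θ hθ r (Finset.mem_range.1 hr))
    have h2 : HasDerivAt (fun θ : ℝ => lam - lam * ((r + 1) * (t / 2 ^ j) * θ))
        (-(lam * ((r + 1) * (t / 2 ^ j)))) θ := by
      have := ((hasDerivAt_id θ).const_mul (lam * ((r + 1) * (t / 2 ^ j)))).const_sub lam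
      simpa [mul_assoc] using this
    have h3 : lam - lam * ((r + 1) * (t / 2 ^ j * θ)) = lam - lam * ((r + 1) * (t / 2 ^ j) * θ) := by
      ring
    rw [h3] at h1 ⊢
    have h4 := (HasDerivAt.scomp θ h1 h2).const_mul (-((((r + 1) * (t / 2 ^ j)) * lam : ℝ) : ℂ)⁻¹)
    refine h4.congr_deriv ?_
    have hne : ((((r + 1) * (t / 2 ^ j)) * lam : ℝ) : ℂ) ≠ 0 := by
      exact_mod_cast (by positivity : ((((r : ℝ) + 1) * (t / 2 ^ j)) * lam) ≠ 0)
    rw [Complex.real_smul, ← mul_assoc]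
    have : -((((r + 1) * (t / 2 ^ j)) * lam : ℝ) : ℂ)⁻¹ *
        ((-(lam * ((r + 1) * (t / 2 ^ j))) : ℝ) : ℂ) = 1 := by
      rw [show -(lam * ((r + 1) * (t / 2 ^ j))) = -(((r + 1) * (t / 2 ^ j)) * lam) by ring,
        Complex.ofReal_neg, neg_mul_neg, inv_mul_cancel₀ hne]
    rw [this, one_mul]
  have hbound : ∀ θ ∈ Icc (1 : ℝ) 2, ‖Y' θ‖ ≤ K * ∫ y, ‖F y‖ ∂ν := by
    intro θ hθ
    have e1 : ∀ j, Integrable (fun y => extrapolation m (fun v => κ (lam - lam * v) y * F y)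
        (t / 2 ^ j * θ)) ν ∧ _ := fun j =>
      integral_extrapolation (u := fun v y => κ (lam - lam * v) y * F y)
        fun r hr => hint _ (hmem j θ hθ r hr)
    have e2 := fun j => integral_increments (fun j => (e1 j).1) j
    -- The kernels are summed under a single integral, since the pointwise bound exploits the whole
    -- weighted sum.
    have e3 : Y' θ = ∫ y, (∑ j ∈ Finset.range (J + 1), c j * increments (fun j =>
        extrapolation m (fun v => κ (lam - lam * v) y) (t / 2 ^ j * θ)) j) * F y ∂ν := by
      have e4 : ∀ y, (∑ j ∈ Finset.range (J + 1), c j * increments (fun j =>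
          extrapolation m (fun v => κ (lam - lam * v) y) (t / 2 ^ j * θ)) j) * F y =
          ∑ j ∈ Finset.range (J + 1), c j * increments (fun j =>
            extrapolation m (fun v => κ (lam - lam * v) y * F y) (t / 2 ^ j * θ)) j := by
        intro y
        simp only [extrapolation_mul_right, increments_mul_right, Finset.sum_mul, mul_assoc]
      simp only [e4]
      rw [integral_finsetSum _ fun j _ => (e2 j).1.const_mul _]
      refine Finset.sum_congr rfl fun j _ => ?_
      rw [integral_const_mul, (e2 j).2]
      congr 2
      funext i
      exact (e1 i).2.symm
    rw [e3, ← integral_const_mul]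
    refine norm_integral_le_of_norm_le (hF.norm.const_mul K) ?_
    filter_upwards [hK] with y hKy
    rw [norm_mul]
    gcongr
    exact hKy θ hθ
  have hmv := (convex_Icc (1 : ℝ) 2).norm_image_sub_le_of_norm_hasDerivWithin_le
    (fun θ hθ => (hder θ hθ).hasDerivWithinAt) hbound (left_mem_Icc.2 one_le_two)
    (right_mem_Icc.2 one_le_two)
  have hfin : (∑ j ∈ Finset.range (J + 1), c j * increments (fun j => y j 2) j) -
      (∑ j ∈ Finset.range (J + 1), c j * increments (fun j => y j 1) j) =
      ∑ j ∈ Finset.range (J + 1), c j * increments (fun j =>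
        extrapolation m (meanDeriv b lam) (t / 2 ^ j)) j := by
    have e0 : ∀ j, extrapolation m (meanDeriv b lam) (t / 2 ^ j) = y j 2 - y j 1 := by
      intro j
      simp only [hy, extrapolation, ← Finset.sum_sub_distrib, meanDeriv, mul_one, smul_eq_mul]
      refine Finset.sum_congr rfl fun r _ => ?_
      ring
    rw [← Finset.sum_sub_distrib]
    refine Finset.sum_congr rfl fun j _ => ?_
    rw [← mul_sub]
    congr 1
    cases j with
    | zero => simp only [increments, e0]
    | succ j => simp only [increments, e0]; ring
  rw [hfin] at hmv
  norm_num at hmv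
  exact hmv

end Integrals

end Multipliers

/-! ### Complex interpolation on simple functions. -/

section Interpolation

variable {X : Type*} [MeasurableSpace X] {μ : Measure X}

theorem norm_sq_eq_integral_norm_sq (f : Lp ℂ 2 μ) : ‖f‖ ^ 2 = ∫ x, ‖f x‖ ^ 2 ∂μ := by
  have h : ((‖f‖ ^ 2 : ℝ) : ℂ) = ((∫ x, ‖f x‖ ^ 2 ∂μ : ℝ) : ℂ) := by
    rw [← integral_complex_ofReal]
    have := inner_self_eq_norm_sq_to_K (𝕜 := ℂ) f
    rw [L2.inner_def] at this
    simp only [inner_self_eq_norm_sq_to_K] at this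
    simpa using this.symm
  exact_mod_cast h

/-- `c ↦ (c / |c|) |c| ^ β`. -/
noncomputable def phasePow (β c : ℂ) : ℂ := c / ‖c‖ * Complex.exp (β * Real.log ‖c‖)

theorem phasePow_zero (β : ℂ) : phasePow β 0 = 0 := by simp [phasePow]

theorem phasePow_one (c : ℂ) : phasePow 1 c = c := by
  rcases eq_or_ne c 0 with rfl | hc
  · exact phasePow_zero 1
  · have h : 0 < ‖c‖ := norm_pos_iff.2 hc
    rw [phasePow, one_mul, ← Complex.ofReal_exp, Real.exp_log h, div_mul_cancel₀]
    exact_mod_cast h.ne'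

theorem norm_phasePow {β : ℂ} (hβ : 0 < β.re) (c : ℂ) : ‖phasePow β c‖ = ‖c‖ ^ β.re := by
  rcases eq_or_ne c 0 with rfl | hc
  · rw [phasePow_zero, norm_zero, Real.zero_rpow hβ.ne']
  · have h : 0 < ‖c‖ := norm_pos_iff.2 hc
    rw [phasePow, norm_mul, norm_div, Complex.norm_real, norm_norm, div_self h.ne', one_mul,
      Complex.norm_exp, Real.rpow_def_of_pos h, Complex.re_mul_ofReal, mul_comm]

theorem norm_phasePow_le (β c : ℂ) : ‖phasePow β c‖ ≤ Real.exp (β.re * Real.log ‖c‖) := by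
  rcases eq_or_ne c 0 with rfl | hc
  · rw [phasePow_zero, norm_zero]
    positivity
  · have h : 0 < ‖c‖ := norm_pos_iff.2 hc
    rw [phasePow, norm_mul, norm_div, Complex.norm_real, norm_norm, div_self h.ne', one_mul,
      Complex.norm_exp, Complex.re_mul_ofReal]

theorem differentiable_phasePow (p : ℝ) (c : ℂ) :
    Differentiable ℂ fun z : ℂ => phasePow (p * (1 + z) / 2) c := by
  unfold phasePow
  fun_prop

/-- The first slot of the inner product is antilinear; evaluating it at the conjugate of `z`
restores holomorphy. -/
theorem differentiable_conj_phasePow (p : ℝ) (c : ℂ) :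
    Differentiable ℂ fun z : ℂ =>
      starRingEnd ℂ (phasePow (p * (1 + starRingEnd ℂ z) / 2) c) := by
  have h : (fun z : ℂ => starRingEnd ℂ (phasePow (p * (1 + starRingEnd ℂ z) / 2) c)) =
      fun z : ℂ => starRingEnd ℂ (c / ‖c‖) * Complex.exp (p * (1 + z) / 2 * Real.log ‖c‖) := by
    funext z
    rw [phasePow, map_mul, ← Complex.exp_conj]
    simp [map_ofNat]
  rw [h]
  fun_prop

namespace MeasureTheory.SimpleFunc

variable (s : SimpleFunc X ℂ)

theorem memLp_comp {p : ℝ≥0∞} (hp0 : p ≠ 0) (hp : p ≠ ∞) (hs : s.FinMeasSupp μ) {φ : ℂ → ℂ}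
    (hφ : φ 0 = 0) : MemLp (fun x => φ (s x)) p μ := by
  have h := (SimpleFunc.memLp_iff_finMeasSupp (f := s.map φ) hp0 hp).2 (hs.map hφ)
  rwa [SimpleFunc.coe_map] at h

/-- The composition of an integrable simple function with a function vanishing at `0`. -/
noncomputable def compLp (hs : s.FinMeasSupp μ) (φ : ℂ → ℂ) (hφ : φ 0 = 0) : Lp ℂ 2 μ :=
  (s.memLp_comp two_ne_zero ENNReal.ofNat_ne_top hs hφ).toLp _

theorem coeFn_compLp (hs : s.FinMeasSupp μ) (φ : ℂ → ℂ) (hφ : φ 0 = 0) :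
    (s.compLp hs φ hφ : X → ℂ) =ᵐ[μ] fun x => φ (s x) := MemLp.coeFn_toLp _

open Classical in
/-- The indicator functions of the level sets of a simple function. -/
noncomputable def levelLp (hs : s.FinMeasSupp μ) (c : ℂ) : Lp ℂ 2 μ :=
  -- The value `c = 0` is excluded because its level set may have infinite measure.
  s.compLp hs (fun y => if y = c ∧ c ≠ 0 then 1 else 0) (by
    rw [if_neg]; rintro ⟨h, h'⟩; exact h' h.symm)

/-- The level vectors do not depend on `φ`. For the analytic family, all dependence on `z` then sits
in finitely many scalars, from which holomorphy and boundedness in the strip can be read off. -/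
theorem compLp_eq_sum (hs : s.FinMeasSupp μ) (φ : ℂ → ℂ) (hφ : φ 0 = 0) :
    s.compLp hs φ hφ = ∑ c ∈ s.range, φ c • s.levelLp hs c := by
  refine Lp.ext ?_
  have h : ∀ᵐ x ∂μ, ∀ c ∈ s.range, (φ c • s.levelLp hs c : Lp ℂ 2 μ) x =
      φ c • (if s x = c ∧ c ≠ 0 then (1 : ℂ) else 0) := by
    rw [eventually_all_finset]
    intro c _
    filter_upwards [Lp.coeFn_smul (φ c) (s.levelLp hs c), s.coeFn_compLp hs
      (fun y => if y = c ∧ c ≠ 0 then 1 else 0) (by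
        rw [if_neg]; rintro ⟨h, h'⟩; exact h' h.symm)] with x h1 h2
    rw [h1, Pi.smul_apply, levelLp, h2]
  filter_upwards [s.coeFn_compLp hs φ hφ, Lp.coeFn_finsetSum s.range fun c => φ c • s.levelLp hs c,
    h] with x h1 h2 h3
  rw [h1, h2, Finset.sum_apply, Finset.sum_congr rfl h3,
    Finset.sum_eq_single (s x)]
  · rcases eq_or_ne (s x) 0 with h0 | h0
    · simp [h0, hφ]
    · simp [h0]
  · intro c _ hc
    rw [if_neg (fun h => hc h.1.symm), smul_zero]
  · intro hx
    exact absurd (s.mem_range_self x) hx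

theorem norm_compLp_sq (hs : s.FinMeasSupp μ) (φ : ℂ → ℂ) (hφ : φ 0 = 0) :
    ‖s.compLp hs φ hφ‖ ^ 2 = ∫ x, ‖φ (s x)‖ ^ 2 ∂μ := by
  rw [norm_sq_eq_integral_norm_sq]
  refine integral_congr_ae ?_
  filter_upwards [s.coeFn_compLp hs φ hφ] with x hx
  rw [hx]

end MeasureTheory.SimpleFunc

open Complex.HadamardThreeLines in
/-- Complex interpolation, between `L² → L²` and `L¹ → L^∞`, for a weighted sum of operators, on
simple functions. -/
theorem norm_inner_sum_le_of_simpleFunc {T : ℕ → Lp ℂ 2 μ →L[ℂ] Lp ℂ 2 μ} {J : ℕ} {M₀ M₁ b : ℝ}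
    (hM₀ : 0 ≤ M₀) (hM₁ : 0 ≤ M₁)
    (h₀ : ∀ c : ℕ → ℂ, (∀ j, ‖c j‖ ≤ (1 / 2) ^ j) → ∀ f g : Lp ℂ 2 μ,
      ‖∑ j ∈ Finset.range J, c j * inner ℂ g (T j f)‖ ≤ M₀ * (‖f‖ * ‖g‖))
    (h₁ : ∀ c : ℕ → ℂ, (∀ j : ℕ, ‖c j‖ ≤ (2 : ℝ) ^ (b * j)) → ∀ f g : Lp ℂ 2 μ,
      MemLp f 1 μ → MemLp g 1 μ →
      ‖∑ j ∈ Finset.range J, c j * inner ℂ g (T j f)‖ ≤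
        M₁ * ((∫ x, ‖f x‖ ∂μ) * ∫ x, ‖g x‖ ∂μ))
    {p θ : ℝ} (hp : 1 ≤ p) (hθ0 : 0 < θ) (hθ1 : θ ≤ 1) (hpθ : p * (1 + θ) = 2)
    (hb : θ⁻¹ - 1 ≤ b) (s : SimpleFunc X ℂ) (hs : s.FinMeasSupp μ) :
    ‖∑ j ∈ Finset.range J, inner ℂ (s.compLp hs id rfl) (T j (s.compLp hs id rfl))‖ ≤
      M₀ ^ (1 - θ) * M₁ ^ θ * (∫ x, ‖s x‖ ^ p ∂μ) ^ (1 + θ) := by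
  set I : ℝ := ∫ x, ‖s x‖ ^ p ∂μ with hI
  have hI0 : 0 ≤ I := integral_nonneg fun x => by positivity
  -- The modulus is `|s|^(p/2)` on `Re z = 0` and `|s|^p` on `Re z = 1`. At `z = θ` the exponent is
  -- `p(1 + θ)/2 = 1`, so that `F θ` is `s`.
  set F : ℂ → Lp ℂ 2 μ := fun z =>
    s.compLp hs (phasePow (p * (1 + z) / 2)) (phasePow_zero _) with hF
  -- These weights have modulus `2^(-j)` on `Re z = 0` and `2^((1/θ-1)j)` on `Re z = 1`, and equal
  -- `1` at `z = θ`, where the unweighted sum is recovered.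
  set ω : ℕ → ℂ → ℂ := fun j z => Complex.exp (-(Real.log 2 * j) * (1 - z / θ)) with hω
  have hωn : ∀ j z, ‖ω j z‖ = (2 : ℝ) ^ ((z.re / θ - 1) * j) := by
    intro j z
    rw [hω, Complex.norm_exp, Real.rpow_def_of_pos two_pos]
    congr 1
    have : (z / (θ : ℂ)).re = z.re / θ := Complex.div_ofReal_re z θ
    have h2 : (-((Real.log 2 : ℂ) * (j : ℂ)) : ℂ) = ((-(Real.log 2 * j) : ℝ) : ℂ) := by push_cast; rfl
    rw [h2, Complex.re_ofReal_mul, Complex.sub_re, this, Complex.one_re]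
    ring
  set G : ℂ → ℂ := fun z => ∑ j ∈ Finset.range J, ω j z *
    inner ℂ (F (starRingEnd ℂ z)) (T j (F z)) with hG
  have hGexp : ∀ z, G z = ∑ j ∈ Finset.range J, ω j z * ∑ c ∈ s.range, ∑ d ∈ s.range,
      starRingEnd ℂ (phasePow (p * (1 + starRingEnd ℂ z) / 2) c) *
        (phasePow (p * (1 + z) / 2) d * inner ℂ (s.levelLp hs c) (T j (s.levelLp hs d))) := by
    intro z
    refine Finset.sum_congr rfl fun j _ => ?_
    congr 1
    simp only [hF]
    rw [s.compLp_eq_sum hs _ (phasePow_zero _), s.compLp_eq_sum hs _ (phasePow_zero _), sum_inner]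
    refine Finset.sum_congr rfl fun c _ => ?_
    rw [map_sum, inner_sum]
    refine Finset.sum_congr rfl fun d _ => ?_
    rw [map_smul, inner_smul_left, inner_smul_right]
  have hdiff : Differentiable ℂ G := by
    rw [funext hGexp]
    refine Differentiable.fun_sum fun j _ => ?_
    have h1 : Differentiable ℂ (ω j) := by
      simp only [hω]
      fun_prop
    refine h1.mul (Differentiable.fun_sum fun c _ => Differentiable.fun_sum fun d _ => ?_)
    exact (differentiable_conj_phasePow p c).mul ((differentiable_phasePow p d).mul_const _)
  have hre : ∀ z : ℂ, ((p : ℂ) * (1 + z) / 2).re = p * (1 + z.re) / 2 := by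
    intro z
    have : (p : ℂ) * (1 + z) / 2 = ((p / 2 : ℝ) : ℂ) * (1 + z) := by push_cast; ring
    rw [this, Complex.re_ofReal_mul]
    simp
    ring
  have hbdd : BddAbove ((norm ∘ G) '' verticalClosedStrip 0 1) := by
    set B : ℝ → ℝ := fun x => ∑ j ∈ Finset.range J, (2 : ℝ) ^ ((x / θ - 1) * j) *
      ∑ c ∈ s.range, ∑ d ∈ s.range, Real.exp (p * (1 + x) / 2 * Real.log ‖c‖) *
        (Real.exp (p * (1 + x) / 2 * Real.log ‖d‖) *
          ‖inner ℂ (s.levelLp hs c) (T j (s.levelLp hs d))‖) with hB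
    have hBc : Continuous B := by
      refine continuous_finsetSum _ fun j _ => Continuous.mul ?_ (by fun_prop)
      exact Continuous.rpow continuous_const (by fun_prop) fun x => Or.inl two_ne_zero
    obtain ⟨M, hM⟩ := (isCompact_Icc (a := (0 : ℝ)) (b := 1)).bddAbove_image hBc.continuousOn
    refine ⟨M, ?_⟩
    rintro _ ⟨z, hz, rfl⟩
    refine le_trans ?_ (hM ⟨z.re, hz, rfl⟩)
    simp only [Function.comp_apply, hGexp, hB]
    refine (norm_sum_le _ _).trans (Finset.sum_le_sum fun j _ => ?_)
    rw [norm_mul, hωn]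
    gcongr
    refine (norm_sum_le _ _).trans (Finset.sum_le_sum fun c _ =>
      (norm_sum_le _ _).trans (Finset.sum_le_sum fun d _ => ?_))
    rw [norm_mul, norm_mul, RCLike.norm_conj]
    have h1 := norm_phasePow_le (p * (1 + starRingEnd ℂ z) / 2) c
    have h2 := norm_phasePow_le (p * (1 + z) / 2) d
    rw [hre] at h1 h2
    rw [Complex.conj_re] at h1
    gcongr
  have hpos : ∀ z : ℂ, 0 ≤ z.re → 0 < ((p : ℂ) * (1 + z) / 2).re := by
    intro z hz
    rw [hre]
    positivity
  have hline0 : ∀ z ∈ Complex.re ⁻¹' {(0 : ℝ)}, ‖G z‖ ≤ M₀ * I := by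
    intro z hz
    have hz : z.re = 0 := hz
    have hn : ∀ w : ℂ, w.re = 0 → ‖F w‖ ^ 2 = I := by
      intro w hw
      simp only [hF]
      rw [s.norm_compLp_sq hs, hI]
      refine integral_congr_ae (Eventually.of_forall fun x => ?_)
      simp only
      rw [norm_phasePow (hpos w hw.ge), hre, hw, ← Real.rpow_natCast, ← Real.rpow_mul (norm_nonneg _)]
      congr 1
      push_cast
      ring
    refine (h₀ (fun j => ω j z) (fun j => ?_) _ _).trans ?_
    · rw [hωn, hz, zero_div, zero_sub, neg_one_mul, Real.rpow_neg two_pos.le, Real.rpow_natCast,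
        one_div, inv_pow]
    · have h1 := hn z hz
      have h2 := hn (starRingEnd ℂ z) (by rw [Complex.conj_re, hz])
      have h3 : ‖F z‖ * ‖F (starRingEnd ℂ z)‖ ≤ I := by
        nlinarith [sq_nonneg (‖F z‖ - ‖F (starRingEnd ℂ z)‖)]
      gcongr
  have hline1 : ∀ z ∈ Complex.re ⁻¹' {(1 : ℝ)}, ‖G z‖ ≤ M₁ * (I * I) := by
    intro z hz
    have hz : z.re = 1 := hz
    have hn : ∀ w : ℂ, w.re = 1 → MemLp (F w) 1 μ ∧ ∫ x, ‖F w x‖ ∂μ = I := by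
      intro w hw
      have hae := s.coeFn_compLp hs (phasePow (p * (1 + w) / 2)) (phasePow_zero _)
      refine ⟨(memLp_congr_ae hae).2 (s.memLp_comp one_ne_zero ENNReal.one_ne_top hs
        (phasePow_zero _)), ?_⟩
      rw [hI]
      refine integral_congr_ae ?_
      filter_upwards [hae] with x hx
      simp only [hF]
      rw [hx, norm_phasePow (hpos w (by rw [hw]; exact zero_le_one)), hre, hw]
      congr 1
      ring
    have h1 := hn z hz
    have h2 := hn (starRingEnd ℂ z) (by rw [Complex.conj_re, hz])
    refine (h₁ (fun j => ω j z) (fun j => ?_) _ _ h1.1 h2.1).trans ?_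
    · rw [hωn, hz, one_div]
      gcongr
      exact one_le_two
    · rw [h1.2, h2.2]
  have h3 := norm_le_interp_of_mem_verticalClosedStrip₀₁' G (z := (θ : ℂ))
    (by simp [verticalClosedStrip, hθ0.le, hθ1]) hdiff.diffContOnCl hbdd hline0 hline1
  have hFθ : F θ = s.compLp hs id rfl := by
    simp only [hF]
    congr 1
    funext c
    rw [show (p : ℂ) * (1 + θ) / 2 = 1 by
      rw [show (p : ℂ) * (1 + θ) = ((p * (1 + θ) : ℝ) : ℂ) by push_cast; ring, hpθ]
      norm_num, phasePow_one]
    rfl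
  have hGθ : G θ = ∑ j ∈ Finset.range J,
      inner ℂ (s.compLp hs id rfl) (T j (s.compLp hs id rfl)) := by
    simp only [hG]
    refine Finset.sum_congr rfl fun j _ => ?_
    have : ω j θ = 1 := by
      simp only [hω]
      rw [div_self (by exact_mod_cast hθ0.ne'), sub_self, mul_zero, Complex.exp_zero]
    rw [this, one_mul, Complex.conj_ofReal, hFθ]
  rw [hGθ, Complex.ofReal_re] at h3
  refine h3.trans (le_of_eq ?_)
  have h1θ : 0 ≤ 1 - θ := by linarith
  rw [Real.mul_rpow hM₀ hI0, Real.mul_rpow hM₁ (by positivity), Real.mul_rpow hI0 hI0,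
    show (1 : ℝ) + θ = (1 - θ) + (θ + θ) by ring,
    Real.rpow_add_of_nonneg hI0 h1θ (by positivity), Real.rpow_add_of_nonneg hI0 hθ0.le hθ0.le]
  ring

end Interpolation

/-! ### Density of the test space, and interpolation beyond simple functions. -/

section Density

variable {X : Type*} [MeasurableSpace X] {μ : Measure X}

/-- Pointwise `|f|^p` is at most `|f|` where `|f| ≤ 1` and at most `|f|²` elsewhere. -/
theorem eLpNorm_rpow_le_add {f : X → ℂ} (hf : AEStronglyMeasurable f μ) {p : ℝ≥0∞} (hp1 : 1 ≤ p)
    (hp2 : p ≤ 2) : eLpNorm f p μ ^ p.toReal ≤ eLpNorm f 1 μ + eLpNorm f 2 μ ^ (2 : ℝ) := by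
  have hpt : p ≠ ∞ := ne_top_of_le_ne_top ENNReal.ofNat_ne_top hp2
  have hp0 : p ≠ 0 := (zero_lt_one.trans_le hp1).ne'
  have hr1 : 1 ≤ p.toReal := by simpa using ENNReal.toReal_mono hpt hp1
  have hr2 : p.toReal ≤ 2 := by simpa using ENNReal.toReal_mono ENNReal.ofNat_ne_top hp2
  have e : ∀ {q : ℝ≥0∞}, q ≠ 0 → q ≠ ∞ → eLpNorm f q μ ^ q.toReal = ∫⁻ x, ‖f x‖ₑ ^ q.toReal ∂μ := by
    intro q hq0 hqt
    rw [eLpNorm_eq_lintegral_rpow_enorm_toReal hq0 hqt, ← ENNReal.rpow_mul, one_div,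
      inv_mul_cancel₀ (ENNReal.toReal_pos hq0 hqt).ne', ENNReal.rpow_one]
  have e2 := e (q := 2) two_ne_zero ENNReal.ofNat_ne_top
  rw [ENNReal.toReal_ofNat] at e2
  rw [e hp0 hpt, e2, eLpNorm_one_eq_lintegral_enorm, ← lintegral_add_left' hf.enorm]
  refine lintegral_mono fun x => ?_
  rcases le_total ‖f x‖ₑ 1 with h | h
  · calc ‖f x‖ₑ ^ p.toReal ≤ ‖f x‖ₑ ^ (1 : ℝ) := ENNReal.rpow_le_rpow_of_exponent_ge h hr1
      _ = ‖f x‖ₑ := ENNReal.rpow_one _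
      _ ≤ _ := le_self_add
  · exact (ENNReal.rpow_le_rpow_of_exponent_le h hr2).trans le_add_self

theorem MeasureTheory.MemLp.of_one_of_two {f : X → ℂ} (h1 : MemLp f 1 μ) (h2 : MemLp f 2 μ)
    {p : ℝ≥0∞} (hp1 : 1 ≤ p) (hp2 : p ≤ 2) : MemLp f p μ := by
  have hpt : p ≠ ∞ := ne_top_of_le_ne_top ENNReal.ofNat_ne_top hp2
  have hp0 : p ≠ 0 := (zero_lt_one.trans_le hp1).ne'
  refine ⟨h1.1, ?_⟩
  have h3 : eLpNorm f p μ ^ p.toReal < ∞ := (eLpNorm_rpow_le_add h1.1 hp1 hp2).trans_lt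
    (ENNReal.add_lt_top.2 ⟨h1.2, ENNReal.rpow_lt_top_of_nonneg two_pos.le h2.2.ne⟩)
  exact (ENNReal.rpow_lt_top_iff_of_pos (ENNReal.toReal_pos hp0 hpt)).1 h3

theorem tendsto_toReal_eLpNorm {p : ℝ≥0∞} [Fact (1 ≤ p)] {u : ℕ → X → ℂ} {f : X → ℂ}
    (hu : ∀ k, MemLp (u k) p μ) (hf : MemLp f p μ)
    (h : Tendsto (fun k => eLpNorm (u k - f) p μ) atTop (𝓝 0)) :
    Tendsto (fun k => (eLpNorm (u k) p μ).toReal) atTop (𝓝 (eLpNorm f p μ).toReal) := by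
  have h1 := ((Lp.tendsto_Lp_iff_tendsto_eLpNorm'' u hu f hf).2 h).norm
  simpa only [Lp.norm_toLp] using h1

theorem integral_norm_eq_toReal_eLpNorm {f : X → ℂ} (hf : MemLp f 1 μ) :
    ∫ x, ‖f x‖ ∂μ = (eLpNorm f 1 μ).toReal := by
  rw [integral_norm_eq_lintegral_enorm hf.1, eLpNorm_one_eq_lintegral_enorm]

section TestSpace

variable {D : Submodule ℂ (Lp ℂ 2 μ)} (hD : IsTestSpace D)
include hD

theorem IsTestSpace.memLp {p : ℝ≥0∞} (hp1 : 1 ≤ p) (hp2 : p ≤ 2) {f : Lp ℂ 2 μ} (hf : f ∈ D) :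
    MemLp f p μ := (hD.1 f hf).of_one_of_two (Lp.memLp f) hp1 hp2

theorem IsTestSpace.exists_seq {h : Lp ℂ 2 μ} (hh : MemLp h 1 μ) :
    ∃ u : ℕ → Lp ℂ 2 μ, (∀ k, u k ∈ D) ∧ Tendsto u atTop (𝓝 h) ∧
      Tendsto (fun k => ∫ x, ‖u k x‖ ∂μ) atTop (𝓝 (∫ x, ‖h x‖ ∂μ)) := by
  have hε : ∀ k : ℕ, (0 : ℝ≥0∞) < ((k : ℝ≥0∞) + 1)⁻¹ := fun k =>
    ENNReal.inv_pos.2 (by finiteness)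
  choose u hu h1 h2 using fun k : ℕ => hD.2 h hh _ (hε k)
  have hlim : Tendsto (fun k : ℕ => ((k : ℝ≥0∞) + 1)⁻¹) atTop (𝓝 0) := by
    have := (tendsto_add_atTop_iff_nat 1).2 ENNReal.tendsto_inv_nat_nhds_zero
    simpa using this
  have t : ∀ q : ℝ≥0∞, (∀ k : ℕ, eLpNorm ((h : X → ℂ) - (u k : X → ℂ)) q μ < ((k : ℝ≥0∞) + 1)⁻¹) →
      Tendsto (fun k => eLpNorm ((u k : X → ℂ) - (h : X → ℂ)) q μ) atTop (𝓝 0) := by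
    intro q hq
    refine tendsto_of_tendsto_of_tendsto_of_le_of_le tendsto_const_nhds hlim
      (fun _ => zero_le) fun k => ?_
    rw [eLpNorm_sub_comm]
    exact (hq k).le
  refine ⟨u, hu, ?_, ?_⟩
  · exact (Lp.tendsto_Lp_iff_tendsto_eLpNorm' u h).2 (t 2 h2)
  · simp_rw [integral_norm_eq_toReal_eLpNorm hh,
      fun k => integral_norm_eq_toReal_eLpNorm (hD.1 (u k) (hu k))]
    exact tendsto_toReal_eLpNorm (fun k => hD.1 (u k) (hu k)) hh (t 1 h1)

/-- An `Lᵖ` function is close to a simple function of finite measure support, which lies in `L¹ ∩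
L²`. Approximation there in both norms controls the `Lᵖ` norm by `eLpNorm_rpow_le_add`. -/
theorem IsTestSpace.exists_eLpNorm_sub_lt {p : ℝ≥0∞} (hp1 : 1 ≤ p) (hp2 : p ≤ 2) {u : X → ℂ}
    (hu : MemLp u p μ) {ε : ℝ≥0∞} (hε : ε ≠ 0) : ∃ f ∈ D, eLpNorm (u - (f : X → ℂ)) p μ < ε := by
  have hpt : p ≠ ∞ := ne_top_of_le_ne_top ENNReal.ofNat_ne_top hp2
  have hp0 : p ≠ 0 := (zero_lt_one.trans_le hp1).ne'
  have hr : 0 < p.toReal := ENNReal.toReal_pos hp0 hpt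
  obtain ⟨s, hs, hsp⟩ := hu.exists_simpleFunc_eLpNorm_sub_lt hpt (ENNReal.half_pos hε).ne'
  have hfin := (SimpleFunc.memLp_iff_finMeasSupp hp0 hpt).1 hsp
  have hs2 : MemLp s 2 μ := (SimpleFunc.memLp_iff_finMeasSupp two_ne_zero ENNReal.ofNat_ne_top).2 hfin
  have hs1 : MemLp s 1 μ := (SimpleFunc.memLp_iff_finMeasSupp one_ne_zero ENNReal.one_ne_top).2 hfin
  obtain ⟨η, hη0, hη⟩ : ∃ η : ℝ≥0∞, 0 < η ∧ η + η ^ (2 : ℝ) < (ε / 2) ^ p.toReal := by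
    have hc : Tendsto (fun η : ℝ≥0∞ => η + η ^ (2 : ℝ)) (𝓝[>] 0) (𝓝 (0 + 0 ^ (2 : ℝ))) :=
      (tendsto_id.add (ENNReal.continuous_rpow_const.tendsto 0)).mono_left nhdsWithin_le_nhds
    have hpos : (0 : ℝ≥0∞) + 0 ^ (2 : ℝ) < (ε / 2) ^ p.toReal := by
      rw [ENNReal.zero_rpow_of_pos two_pos, add_zero]
      exact ENNReal.rpow_pos_of_nonneg (ENNReal.half_pos hε) hr.le
    obtain ⟨η, h1, h2⟩ := ((hc.eventually (gt_mem_nhds hpos)).and self_mem_nhdsWithin).exists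
    exact ⟨η, h2, h1⟩
  have hae := hs2.coeFn_toLp
  obtain ⟨f, hf, hf1, hf2⟩ := hD.2 (hs2.toLp s) ((memLp_congr_ae hae).2 hs1) η hη0
  refine ⟨f, hf, ?_⟩
  have hcongr : ((hs2.toLp s : Lp ℂ 2 μ) : X → ℂ) - (f : X → ℂ) =ᵐ[μ] (s : X → ℂ) - (f : X → ℂ) := hae.sub (ae_eq_refl _)
  rw [eLpNorm_congr_ae hcongr] at hf1 hf2
  have hsf : eLpNorm ((s : X → ℂ) - (f : X → ℂ)) p μ < ε / 2 := by
    rw [← ENNReal.rpow_lt_rpow_iff hr]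
    refine (eLpNorm_rpow_le_add (hs1.1.sub (Lp.aestronglyMeasurable f)) hp1 hp2).trans_lt
      (lt_of_le_of_lt ?_ hη)
    gcongr
  have hadd := eLpNorm_add_le (hu.1.sub hsp.1) (hsp.1.sub (Lp.aestronglyMeasurable f)) hp1
  rw [sub_add_sub_cancel] at hadd
  exact hadd.trans_lt ((ENNReal.add_lt_add hs hsf).trans_eq (ENNReal.add_halves ε))

/-- The inclusion of the test space in `Lᵖ`. -/
noncomputable def IsTestSpace.toLp (p : ℝ≥0∞) (hp1 : 1 ≤ p) (hp2 : p ≤ 2) : D →ₗ[ℂ] Lp ℂ p μ where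
  toFun f := (hD.memLp hp1 hp2 f.2).toLp _
  map_add' f g := by
    rw [← MemLp.toLp_add]
    exact MemLp.toLp_congr _ _ (Lp.coeFn_add _ _)
  map_smul' c f := by
    rw [RingHom.id_apply, ← MemLp.toLp_const_smul]
    exact MemLp.toLp_congr _ _ (Lp.coeFn_smul _ _)

theorem IsTestSpace.coeFn_toLp {p : ℝ≥0∞} (hp1 : 1 ≤ p) (hp2 : p ≤ 2) (f : D) :
    (hD.toLp p hp1 hp2 f : X → ℂ) =ᵐ[μ] (f : Lp ℂ 2 μ) :=
  MemLp.coeFn_toLp (hD.memLp hp1 hp2 f.2)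

theorem IsTestSpace.norm_toLp {p : ℝ≥0∞} (hp1 : 1 ≤ p) (hp2 : p ≤ 2) (f : D) :
    ‖hD.toLp p hp1 hp2 f‖ = (eLpNorm (f : Lp ℂ 2 μ) p μ).toReal :=
  Lp.norm_toLp _ (hD.memLp hp1 hp2 f.2)

theorem IsTestSpace.denseRange_toLp {p : ℝ≥0∞} [Fact (1 ≤ p)] (hp1 : 1 ≤ p) (hp2 : p ≤ 2) :
    DenseRange (hD.toLp p hp1 hp2) := by
  intro u
  rw [EMetric.mem_closure_iff]
  intro ε hε
  obtain ⟨f, hf, h⟩ := hD.exists_eLpNorm_sub_lt hp1 hp2 (Lp.memLp u) hε.ne'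
  refine ⟨_, ⟨⟨f, hf⟩, rfl⟩, ?_⟩
  rw [Lp.edist_def]
  refine lt_of_eq_of_lt (eLpNorm_congr_ae ?_) h
  exact (ae_eq_refl _).sub (hD.coeFn_toLp hp1 hp2 ⟨f, hf⟩)

theorem IsTestSpace.dense : Dense (D : Set (Lp ℂ 2 μ)) := by
  intro u
  rw [EMetric.mem_closure_iff]
  intro ε hε
  obtain ⟨f, hf, h⟩ := hD.exists_eLpNorm_sub_lt one_le_two le_rfl (Lp.memLp u) hε.ne'
  exact ⟨f, hf, by rwa [Lp.edist_def]⟩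

end TestSpace

/-- Complex interpolation between `L² → L²` and `L¹ → L^∞` for a weighted sum of operators. -/
theorem norm_inner_sum_le {T : ℕ → Lp ℂ 2 μ →L[ℂ] Lp ℂ 2 μ} {J : ℕ} {M₀ M₁ b : ℝ}
    (hM₀ : 0 ≤ M₀) (hM₁ : 0 ≤ M₁)
    (h₀ : ∀ c : ℕ → ℂ, (∀ j, ‖c j‖ ≤ (1 / 2) ^ j) → ∀ f g : Lp ℂ 2 μ,
      ‖∑ j ∈ Finset.range J, c j * inner ℂ g (T j f)‖ ≤ M₀ * (‖f‖ * ‖g‖))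
    (h₁ : ∀ c : ℕ → ℂ, (∀ j : ℕ, ‖c j‖ ≤ (2 : ℝ) ^ (b * j)) → ∀ f g : Lp ℂ 2 μ,
      MemLp f 1 μ → MemLp g 1 μ →
      ‖∑ j ∈ Finset.range J, c j * inner ℂ g (T j f)‖ ≤
        M₁ * ((∫ x, ‖f x‖ ∂μ) * ∫ x, ‖g x‖ ∂μ))
    {p : ℝ≥0∞} {θ : ℝ} [hp : Fact (1 ≤ p)] (hpt : p ≠ ∞) (hθ0 : 0 < θ) (hθ1 : θ ≤ 1)
    (hpθ : p.toReal * (1 + θ) = 2) (hb : θ⁻¹ - 1 ≤ b) {f : Lp ℂ 2 μ} (hf : MemLp f p μ) :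
    ‖∑ j ∈ Finset.range J, inner ℂ f (T j f)‖ ≤
      M₀ ^ (1 - θ) * M₁ ^ θ * (eLpNorm f p μ).toReal ^ 2 := by
  have hp0 : p ≠ 0 := (zero_lt_one.trans_le hp.out).ne'
  have hr1 : 1 ≤ p.toReal := by simpa using ENNReal.toReal_mono hpt hp.out
  have hfm : Measurable f := (Lp.stronglyMeasurable f).measurable
  have hsep : TopologicalSpace.SeparableSpace ↑(range f ∪ {0}) := inferInstance
  -- These approximants do not depend on the exponent, so they converge to `f` in `L²` and in `Lᵖ`
  -- simultaneously.
  set s : ℕ → SimpleFunc X ℂ := fun k =>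
    SimpleFunc.approxOn f hfm (range f ∪ {0}) 0 (by simp) k with hsdef
  have hsp : ∀ k, MemLp (s k) p μ := fun k => SimpleFunc.memLp_approxOn_range hfm hf k
  have hfin : ∀ k, (s k).FinMeasSupp μ := fun k =>
    (SimpleFunc.memLp_iff_finMeasSupp hp0 hpt).1 (hsp k)
  have hs2 : ∀ k, MemLp (s k) 2 μ := fun k =>
    (SimpleFunc.memLp_iff_finMeasSupp two_ne_zero ENNReal.ofNat_ne_top).2 (hfin k)
  have hlim2 : Tendsto (fun k => eLpNorm ((s k : X → ℂ) - (f : X → ℂ)) 2 μ) atTop (𝓝 0) :=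
    SimpleFunc.tendsto_approxOn_range_Lp_eLpNorm ENNReal.ofNat_ne_top hfm (Lp.memLp f).2
  have hlimp : Tendsto (fun k => eLpNorm ((s k : X → ℂ) - (f : X → ℂ)) p μ) atTop (𝓝 0) :=
    SimpleFunc.tendsto_approxOn_range_Lp_eLpNorm hpt hfm hf.2
  have hu : Tendsto (fun k => (s k).compLp (hfin k) id rfl) atTop (𝓝 f) := by
    have h1 := (Lp.tendsto_Lp_iff_tendsto_eLpNorm'' (fun k => s k) hs2 f (Lp.memLp f)).2 hlim2
    rwa [Lp.toLp_coeFn] at h1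
  have hcont : Continuous fun f : Lp ℂ 2 μ => ‖∑ j ∈ Finset.range J, inner ℂ f (T j f)‖ := by
    fun_prop
  have hR := (tendsto_toReal_eLpNorm hsp hf hlimp).pow 2 |>.const_mul (M₀ ^ (1 - θ) * M₁ ^ θ)
  refine le_of_tendsto_of_tendsto' ((hcont.tendsto f).comp hu) hR fun k => ?_
  refine (norm_inner_sum_le_of_simpleFunc hM₀ hM₁ h₀ h₁ hr1 hθ0 hθ1 hpθ hb (s k)
    (hfin k)).trans_eq ?_
  congr 1
  have hI0 : 0 ≤ ∫ x, ‖s k x‖ ^ p.toReal ∂μ := integral_nonneg fun x => by positivity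
  rw [(hsp k).eLpNorm_eq_integral_rpow_norm hp0 hpt, ENNReal.toReal_ofReal (by positivity),
    ← Real.rpow_natCast, ← Real.rpow_mul hI0]
  congr 1
  have : p.toReal ≠ 0 := by linarith
  field_simp
  push_cast
  linarith

end Density

/-! ### The restriction estimate for one operator of the partition of unity. -/

section Restriction

/-- Differentiability at `lam` alone suffices: the mean derivative is a difference of two difference
quotients based at `lam`, with slopes in the ratio `1 : 2`. -/
theorem HasDerivAt.tendsto_meanDeriv {b : ℝ → ℂ} {b' : ℂ} {lam : ℝ} (hlam : 0 < lam)
    (hb : HasDerivAt b b' lam) : Tendsto (meanDeriv b lam) (𝓝[>] 0) (𝓝 b') := by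
  have h1 : HasDerivAt (fun v : ℝ => b (lam - lam * v)) ((-lam) • b') 0 := by
    have h2 : HasDerivAt (fun v : ℝ => lam - lam * v) (-lam) 0 := by
      simpa using ((hasDerivAt_id (0 : ℝ)).const_mul lam).const_sub lam
    exact HasDerivAt.scomp (𝕜 := ℝ) (𝕜' := ℝ) 0 (by simpa using hb) h2
  have h3 : HasDerivAt (fun v : ℝ => b (lam - lam * (v * 2))) ((-(lam * 2)) • b') 0 := by
    have h2 : HasDerivAt (fun v : ℝ => lam - lam * (v * 2)) (-(lam * 2)) 0 := by
      simpa using (((hasDerivAt_id (0 : ℝ)).mul_const 2).const_mul lam).const_sub lam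
    exact HasDerivAt.scomp (𝕜 := ℝ) (𝕜' := ℝ) 0 (by simpa using hb) h2
  have h4 := ((h1.sub h3).tendsto_slope_zero_right).const_smul (lam⁻¹)
  have e1 : lam⁻¹ • ((-lam) • b' - (-(lam * 2)) • b') = b' := by
    rw [← sub_smul, smul_smul, show lam⁻¹ * (-lam - -(lam * 2)) = 1 by field_simp; ring, one_smul]
  rw [e1] at h4
  refine h4.congr fun v => ?_
  simp only [Pi.sub_apply, zero_add, mul_zero, zero_mul, sub_zero, sub_self, meanDeriv,
    smul_eq_mul, Complex.real_smul, mul_inv, Complex.ofReal_mul, Complex.ofReal_inv]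
  ring

theorem tendsto_extrapolation_meanDeriv {b : ℝ → ℂ} {b' : ℂ} {lam t : ℝ} (hlam : 0 < lam)
    (ht : 0 < t) (hb : HasDerivAt b b' lam) {m : ℕ} (hm : 0 < m) :
    Tendsto (fun J : ℕ => extrapolation m (meanDeriv b lam) (t / 2 ^ J)) atTop (𝓝 b') := by
  have h1 : ∀ r : ℕ, Tendsto (fun J : ℕ => meanDeriv b lam ((r + 1) * (t / 2 ^ J))) atTop (𝓝 b') := by
    intro r
    refine (hb.tendsto_meanDeriv hlam).comp (tendsto_nhdsWithin_iff.2 ⟨?_, ?_⟩)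
    · have h2 : Tendsto (fun J : ℕ => ((1 : ℝ) / 2) ^ J) atTop (𝓝 0) :=
        tendsto_pow_atTop_nhds_zero_of_lt_one (by norm_num) (by norm_num)
      have h3 := h2.const_mul ((r + 1) * t)
      rw [mul_zero] at h3
      refine h3.congr fun J => ?_
      rw [one_div, inv_pow]
      ring
    · exact Eventually.of_forall fun J => by
        rw [mem_Ioi]
        positivity
  have h2 := tendsto_finsetSum (Finset.range m) fun r _ =>
    (h1 r).const_smul ((-1) ^ r * (m.choose (r + 1) : ℂ))
  rw [← Finset.sum_smul, sum_extrapolation_coeff hm, one_smul] at h2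
  exact h2

variable {X : Type*} [MeasurableSpace X] {μ : Measure X}

/-- The matrix coefficient `⟨A f, g⟩` as a linear functional of the operator `A`. -/
noncomputable def matrixCoeff {H : Type*} [NormedAddCommGroup H] [InnerProductSpace ℂ H] (f g : H) :
    (H →L[ℂ] H) →ₗ[ℂ] ℂ where
  toFun A := inner ℂ g (A f)
  map_add' A B := by simp
  map_smul' c A := by simp

theorem inner_increments_apply {H : Type*} [NormedAddCommGroup H] [InnerProductSpace ℂ H]
    (B : ℝ → H →L[ℂ] H) (m : ℕ) (lam t : ℝ) (j : ℕ) (f g : H) :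
    inner ℂ g (increments (fun j => extrapolation m (meanDeriv B lam) (t / 2 ^ j)) j f) =
      increments (fun j => extrapolation m (meanDeriv (fun s => inner ℂ g (B s f)) lam)
        (t / 2 ^ j)) j := by
  have h := map_increments (matrixCoeff f g)
    (fun j => extrapolation m (meanDeriv B lam) (t / 2 ^ j)) j
  simp only [map_extrapolation, map_meanDeriv] at h
  exact h

/-- A kernel satisfying the spectral measure estimates is bounded. -/
theorem norm_kernel_le {n : ℕ} (hn : 1 ≤ n) {C s w : ℝ} (hC : 0 ≤ C) (hs : 0 < s) (hw : 0 ≤ w)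
    {z : ℂ} (hz : ‖z‖ ≤ C * s ^ ((n : ℝ) - 1 - (0 : ℕ)) * (1 + s * w) ^ (-((n : ℝ) - 1) / 2 + (0 : ℕ))) :
    ‖z‖ ≤ C * s ^ ((n : ℝ) - 1) := by
  have hn' : (1 : ℝ) ≤ n := by exact_mod_cast hn
  simp only [Nat.cast_zero, sub_zero, add_zero] at hz
  refine hz.trans (mul_le_of_le_one_right (by positivity) ?_)
  exact Real.rpow_le_one_of_one_le_of_nonpos (by nlinarith [mul_nonneg hs.le hw]) (by linarith)

theorem integrable_tensor [SFinite μ] {f g : X → ℂ} (hf : MemLp f 1 μ) (hg : MemLp g 1 μ) :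
    Integrable (fun x : X × X => f x.2 * starRingEnd ℂ (g x.1)) (μ.prod μ) := by
  have h1 : Integrable (fun x => starRingEnd ℂ (g x)) μ :=
    (memLp_one_iff_integrable.1 hg.star)
  simpa only [mul_comm] using h1.mul_prod (memLp_one_iff_integrable.1 hf)

theorem integral_norm_tensor [SFinite μ] (f g : X → ℂ) :
    ∫ x : X × X, ‖f x.2 * starRingEnd ℂ (g x.1)‖ ∂(μ.prod μ) =
      (∫ x, ‖f x‖ ∂μ) * ∫ x, ‖g x‖ ∂μ := by
  have h := integral_prod_mul (μ := μ) (ν := μ) (fun x => ‖g x‖) (fun x => ‖f x‖)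
  rw [mul_comm, ← h]
  congr 1
  funext x
  rw [norm_mul, RCLike.norm_conj, mul_comm]

/-- Serves to replace the constant by a nonnegative one. -/
theorem SpectralMeasureEstimates.mono {n : ℕ} {E : ℝ → Lp ℂ 2 μ →L[ℂ] Lp ℂ 2 μ}
    {D : Submodule ℂ (Lp ℂ 2 μ)} {N : ℝ → ℕ} {Q : ℝ → ℕ → Lp ℂ 2 μ →L[ℂ] Lp ℂ 2 μ}
    {w : X → X → ℝ} (hw : ∀ z z', 0 ≤ w z z') {δ C C' : ℝ} (hδ1 : δ < 1)
    (h : SpectralMeasureEstimates n E D N Q w δ C) (hC : C ≤ C') :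
    SpectralMeasureEstimates n E D N Q w δ C' := by
  intro lam hess hlam i hi
  obtain ⟨κ, h1, h2⟩ := h lam hess hlam i hi
  refine ⟨κ, h1, ?_⟩
  filter_upwards [h2] with x hx
  refine ⟨hx.1, fun k hk s hs => (hx.2 k hk s hs).trans ?_⟩
  have hs0 : 0 < s := lt_trans (mul_pos (by linarith) hlam) hs.1
  have := mul_nonneg hs0.le (hw x.1 x.2)
  gcongr

/-- The constant in the restriction estimate for a single operator of the partition of unity. -/
noncomputable def restrictionConst (n : ℕ) (δ B C : ℝ) : ℝ :=
  -- The entries are the kernel bound for `n = 1`, the `L²` endpoint with `1 / t = 8 m / δ`, and the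
  -- `L¹ → L^∞` endpoint.
  max C (max (2 ^ ((n + 1) / 2 + 1) * (8 * ((n + 1) / 2 : ℕ) / δ) * B ^ 2) (kernelConst n * C))

theorem restrictionConst_nonneg (n : ℕ) (δ B : ℝ) {C : ℝ} (hC : 0 ≤ C) :
    0 ≤ restrictionConst n δ B C := hC.trans (le_max_left _ _)

/-- The restriction estimate for a single operator of the partition of unity. -/
theorem SpectralMeasureEstimates.norm_deriv_le [SigmaFinite μ] {n : ℕ} {E : ℝ → Lp ℂ 2 μ →L[ℂ] Lp ℂ 2 μ}
    (hE : IsProjectionFamily E) {D : Submodule ℂ (Lp ℂ 2 μ)} (hD : IsTestSpace D) {N : ℝ → ℕ}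
    {Q : ℝ → ℕ → Lp ℂ 2 μ →L[ℂ] Lp ℂ 2 μ} {w : X → X → ℝ} (hw : ∀ z z', 0 ≤ w z z')
    {δ C B : ℝ} (hδ : 0 < δ) (hδ1 : δ < 1) (hC : 0 ≤ C)
    (hest : SpectralMeasureEstimates n E D N Q w δ C) (hn : 1 ≤ n) {p : ℝ≥0∞} [hp : Fact (1 ≤ p)]
    (hpt : p ≠ ∞) {θ : ℝ} (hθ0 : 0 < θ) (hθ1 : θ ≤ 1) (hpθ : p.toReal * (1 + θ) = 2)
    (hnθ : 2 ≤ θ * (n + 1)) {lam : ℝ} (hlam : 0 < lam) (hess : lam ∈ essSpectrum E) {i : ℕ}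
    (hi : i < N lam) (hB : ‖Q lam i‖ ≤ B) {f : Lp ℂ 2 μ} (hf : f ∈ D) :
    ∃ c : ℂ, HasSpectralDensityAt
      (fun t => (Q lam i).comp ((E t).comp (ContinuousLinearMap.adjoint (Q lam i)))) lam f f c ∧
      ‖c‖ ≤ restrictionConst n δ B C * lam ^ (n * θ - 1) * (eLpNorm f p μ).toReal ^ 2 := by
  obtain ⟨κ, hκ, hae⟩ := hest lam hess hlam i hi
  set I := Ioo ((1 - δ) * lam) ((1 + δ) * lam) with hI
  have hlamI : lam ∈ I := by rw [hI, mem_Ioo]; constructor <;> nlinarith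
  have hI0 : ∀ s ∈ I, 0 < s := fun s hs => lt_trans (mul_pos (by linarith) hlam) hs.1
  set Bop : ℝ → Lp ℂ 2 μ →L[ℂ] Lp ℂ 2 μ := fun t =>
    (Q lam i).comp ((E t).comp (ContinuousLinearMap.adjoint (Q lam i))) with hBop
  set R := restrictionConst n δ B C with hR
  have hR0 : 0 ≤ R := restrictionConst_nonneg n δ B hC
  have hκbd : ∀ s ∈ I, ∀ᵐ x : X × X ∂(μ.prod μ), ‖κ s x.1 x.2‖ ≤ C * s ^ ((n : ℝ) - 1) := by
    intro s hs
    filter_upwards [hae] with x hx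
    refine norm_kernel_le hn hC (hI0 s hs) (hw x.1 x.2) ?_
    simpa only [iteratedDeriv_zero] using hx.2 0 (Nat.zero_le _) s hs
  have hkint : ∀ f ∈ D, ∀ g ∈ D, ∀ s ∈ I, Integrable
      (fun x : X × X => κ s x.1 x.2 * (f x.2 * starRingEnd ℂ (g x.1))) (μ.prod μ) :=
    fun f hf g hg s hs => (integrable_tensor (hD.1 f hf) (hD.1 g hg)).bdd_mul (hκ s hs).1 (hκbd s hs)
  have hder : ∀ f ∈ D, ∀ g ∈ D, ∀ s ∈ I, HasDerivAt (fun t => inner ℂ g (Bop t f))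
      (∫ x : X × X, κ s x.1 x.2 * (f x.2 * starRingEnd ℂ (g x.1)) ∂(μ.prod μ)) s := by
    intro f hf g hg s hs
    have := (hκ s hs).2 f hf g hg
    simp only [mul_assoc] at this
    exact this
  refine ⟨_, hder f hf f hf lam hlamI, ?_⟩
  -- For `n = 1` the admissible range is the single exponent `p = 1`, and the kernel bound of order
  -- `0` at `s = lam` is enough.
  rcases hn.eq_or_lt with rfl | hn2
  · have hθ : θ = 1 := by push_cast at hnθ; linarith
    subst hθ
    have hp1 : p = 1 := by
      rw [← ENNReal.ofReal_toReal hpt, show p.toReal = 1 by linarith, ENNReal.ofReal_one]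
    subst hp1
    have h1 : ‖∫ x : X × X, κ lam x.1 x.2 * (f x.2 * starRingEnd ℂ (f x.1)) ∂(μ.prod μ)‖ ≤
        ∫ x : X × X, (C * lam ^ (((1 : ℕ) : ℝ) - 1)) * ‖f x.2 * starRingEnd ℂ (f x.1)‖ ∂(μ.prod μ) := by
      refine norm_integral_le_of_norm_le
        ((integrable_tensor (hD.1 f hf) (hD.1 f hf)).norm.const_mul _) ?_
      filter_upwards [hκbd lam hlamI] with x hx
      rw [norm_mul]
      gcongr
    rw [integral_const_mul, integral_norm_tensor, integral_norm_eq_toReal_eLpNorm (hD.1 f hf)] at h1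
    refine h1.trans ?_
    rw [← sq, mul_one]
    have : C ≤ R := le_max_left _ _
    gcongr
  set m := (n + 1) / 2 with hm
  have hm0 : 0 < m := by omega
  have hm1 : (1 : ℝ) ≤ m := by exact_mod_cast hm0
  -- With this `t` every node stays above `lam (1 - 2 m t) = lam (1 - δ/4)`, inside the half-width
  -- window of the kernel bound.
  set t : ℝ := δ / (8 * m) with ht
  have ht0 : 0 < t := by positivity
  have hmt : m * t = δ / 8 := by rw [ht]; field_simp
  have ht1 : 2 * t ≤ 1 := by nlinarith
  set T : ℕ → Lp ℂ 2 μ →L[ℂ] Lp ℂ 2 μ := fun j =>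
    increments (fun j => extrapolation m (meanDeriv Bop lam) (t / 2 ^ j)) j with hT
  have hTapp : ∀ j (f g : Lp ℂ 2 μ), inner ℂ g (T j f) = increments (fun j =>
      extrapolation m (meanDeriv (fun s => inner ℂ g (Bop s f)) lam) (t / 2 ^ j)) j :=
    fun j f g => inner_increments_apply Bop m lam t j f g
  have hBapp : ∀ s (f g : Lp ℂ 2 μ), inner ℂ g (Bop s f) =
      inner ℂ (ContinuousLinearMap.adjoint (Q lam i) g)
        (E s (ContinuousLinearMap.adjoint (Q lam i) f)) := by
    intro s f g
    rw [ContinuousLinearMap.adjoint_inner_left]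
    rfl
  have hH0 : ∀ J, ∀ c : ℕ → ℂ, (∀ j, ‖c j‖ ≤ (1 / 2) ^ j) → ∀ f g : Lp ℂ 2 μ,
      ‖∑ j ∈ Finset.range (J + 1), c j * inner ℂ g (T j f)‖ ≤ (R * lam⁻¹) * (‖f‖ * ‖g‖) := by
    intro J c hc f g
    simp only [hTapp, hBapp]
    refine (hE.norm_sum_mul_increments_le m hlam ht0 hc J _ _).trans ?_
    have hadj : ∀ f, ‖ContinuousLinearMap.adjoint (Q lam i) f‖ ≤ B * ‖f‖ := fun f =>
      (ContinuousLinearMap.adjoint (Q lam i)).le_of_opNorm_le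
        (by rwa [LinearIsometryEquiv.norm_map]) f
    have hB0 : 0 ≤ B := (norm_nonneg _).trans hB
    calc _ ≤ 2 ^ (m + 1) * ((t * lam)⁻¹ * ((B * ‖f‖) * (B * ‖g‖))) := by
          gcongr
          · exact hadj f
          · exact hadj g
      _ = (2 ^ (m + 1) * (8 * m / δ) * B ^ 2) * lam⁻¹ * (‖f‖ * ‖g‖) := by
          rw [ht]
          field_simp
      _ ≤ _ := by
          have : 2 ^ (m + 1) * (8 * m / δ) * B ^ 2 ≤ R :=
            (le_max_left _ _).trans (le_max_right _ _)
          gcongr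
  have hH1D : ∀ J, ∀ c : ℕ → ℂ, (∀ j : ℕ, ‖c j‖ ≤ (2 : ℝ) ^ (((n : ℝ) - 1) / 2 * j)) →
      ∀ f ∈ D, ∀ g ∈ D, ‖∑ j ∈ Finset.range (J + 1), c j * inner ℂ g (T j f)‖ ≤
        (R * lam ^ ((n : ℝ) - 1)) * ((∫ x, ‖f x‖ ∂μ) * ∫ x, ‖g x‖ ∂μ) := by
    intro J c hc f hf g hg
    simp only [hTapp]
    refine (norm_sum_mul_increments_meanDeriv_le (I := I)
      (κ := fun s x => κ s x.1 x.2) (K := kernelConst n * (C * lam ^ ((n : ℝ) - 1)))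
      (hkint f hf g hg) (integrable_tensor (hD.1 f hf) (hD.1 g hg)) (hder f hf g hg) hlam ht0 ?_ c J
      ?_).trans ?_
    · intro v hv0 hv
      rw [hI, mem_Ioo]
      constructor <;> nlinarith
    · filter_upwards [hae] with x hx θ hθ
      exact norm_sum_mul_increments_extrapolation_le hn2 hδ hδ1 hlam (hw x.1 x.2) hx.1 hx.2 hc J
        (by linarith [hθ.1]) hθ.2 ht0.le ht1 (by rw [← hm, hmt]; linarith)
    · rw [integral_norm_tensor, ← mul_assoc (kernelConst n)]
      have : kernelConst n * C ≤ R := (le_max_right _ _).trans (le_max_right _ _)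
      gcongr
  -- The kernel represents the forms only on `D`. For fixed `J` the sum is continuous on `L²`, so
  -- approximation in `L¹` and `L²` at once extends the bound.
  have hH1 : ∀ J, ∀ c : ℕ → ℂ, (∀ j : ℕ, ‖c j‖ ≤ (2 : ℝ) ^ (((n : ℝ) - 1) / 2 * j)) →
      ∀ f g : Lp ℂ 2 μ, MemLp f 1 μ → MemLp g 1 μ →
      ‖∑ j ∈ Finset.range (J + 1), c j * inner ℂ g (T j f)‖ ≤
        (R * lam ^ ((n : ℝ) - 1)) * ((∫ x, ‖f x‖ ∂μ) * ∫ x, ‖g x‖ ∂μ) := by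
    intro J c hc f g hf1 hg1
    obtain ⟨u, huD, hu, hu1⟩ := hD.exists_seq hf1
    obtain ⟨v, hvD, hv, hv1⟩ := hD.exists_seq hg1
    have hcont : Continuous fun q : Lp ℂ 2 μ × Lp ℂ 2 μ =>
        ‖∑ j ∈ Finset.range (J + 1), c j * inner ℂ q.2 (T j q.1)‖ := by fun_prop
    exact le_of_tendsto_of_tendsto' ((hcont.tendsto (f, g)).comp (hu.prodMk_nhds hv))
      ((hu1.mul hv1).const_mul _) fun k => hH1D J c hc _ (huD k) _ (hvD k)
  have hmain : ∀ J : ℕ, ‖extrapolation m (meanDeriv (fun s => inner ℂ f (Bop s f)) lam) (t / 2 ^ J)‖ ≤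
      R * lam ^ (n * θ - 1) * (eLpNorm f p μ).toReal ^ 2 := by
    intro J
    -- Here the upper limit on `p` enters: `2 ≤ θ (n + 1)` makes the interpolation weights
    -- admissible at the `L¹` endpoint.
    have hb : θ⁻¹ - 1 ≤ ((n : ℝ) - 1) / 2 := by
      have : θ⁻¹ ≤ ((n : ℝ) + 1) / 2 := by
        rw [inv_eq_one_div, div_le_div_iff₀ hθ0 two_pos]
        linarith
      linarith
    have hp2 : p ≤ 2 := by
      rw [← ENNReal.ofReal_toReal hpt, ← ENNReal.ofReal_ofNat]
      refine ENNReal.ofReal_le_ofReal ?_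
      nlinarith [ENNReal.toReal_nonneg (a := p)]
    have h := norm_inner_sum_le (T := T) (J := J + 1) (by positivity) (by positivity) (hH0 J)
      (hH1 J) hpt hθ0 hθ1 hpθ hb (hD.memLp hp.out hp2 hf)
    -- With unit weights the increments telescope to the extrapolation at scale `t / 2^J`; the bound
    -- does not depend on `J` and survives the limit.
    simp only [hTapp, sum_increments] at h
    refine h.trans (le_of_eq ?_)
    congr 1
    have h1θ : 0 ≤ 1 - θ := by linarith
    rw [Real.mul_rpow hR0 (by positivity), Real.mul_rpow hR0 (by positivity), ← Real.rpow_neg_one,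
      ← Real.rpow_mul hlam.le, ← Real.rpow_mul hlam.le]
    calc _ = (R ^ (1 - θ) * R ^ θ) * (lam ^ (-1 * (1 - θ)) * lam ^ (((n : ℝ) - 1) * θ)) := by ring
      _ = _ := by
        rw [← Real.rpow_add_of_nonneg hR0 h1θ hθ0.le, ← Real.rpow_add hlam, sub_add_cancel,
          Real.rpow_one]
        congr 2
        ring
  exact le_of_tendsto
    (tendsto_extrapolation_meanDeriv hlam ht0 (hder f hf f hf lam hlamI) hm0).norm
    (Eventually.of_forall hmain)

end Restriction

/-! ### Converse of Hölder's inequality. -/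

section LpDuality

variable {X : Type*} [MeasurableSpace X] {μ : Measure X}

theorem memLp_of_bounded_of_support {w : X → ℂ} (hw : Measurable w) {A : Set X}
    (hA : MeasurableSet A) (hAμ : μ A < ∞) {M : ℝ} (hM : ∀ x, ‖w x‖ ≤ M) (h0 : ∀ x ∉ A, w x = 0)
    (p : ℝ≥0∞) : MemLp w p μ := by
  have h1 : w = A.indicator w := by
    funext x
    by_cases hx : x ∈ A
    · simp [hx]
    · simp [hx, h0 x hx]
  rw [h1, memLp_indicator_iff_restrict hA]
  have : IsFiniteMeasure (μ.restrict A) := ⟨by simpa using hAμ⟩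
  exact MemLp.of_bound hw.aestronglyMeasurable M (Eventually.of_forall hM)

/-- Converse of Hölder's inequality: the `L^q` norm of `k` is controlled by the integrals of `k`
against bounded functions supported in the sets of an exhaustion by sets of finite measure. -/
theorem eLpNorm_le_of_forall_bounded {k : X → ℂ} (hk : Measurable k) {A : ℕ → Set X}
    (hA : ∀ n, MeasurableSet (A n)) (hAμ : ∀ n, μ (A n) < ∞) (hmono : Monotone A)
    (hU : ⋃ n, A n = univ) {C : ℝ} (hC : 0 ≤ C) {p q : ℝ≥0∞} [hp : Fact (1 ≤ p)]
    [hpq : p.HolderConjugate q] (hptop : p ≠ ∞)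
    (h : ∀ n (w : X → ℂ), Measurable w → (∃ M : ℝ, ∀ x, ‖w x‖ ≤ M) → (∀ x ∉ A n, w x = 0) →
      ‖∫ x, k x * w x ∂μ‖ ≤ C * (eLpNorm w p μ).toReal) :
    eLpNorm k q μ ≤ ENNReal.ofReal C := by
  -- Cutting off the size of `k` as well as the support makes the extremal test functions bounded
  -- and all integrals finite.
  set B : ℕ → Set X := fun n => A n ∩ {x | ‖k x‖ ≤ n} with hB
  have hBm : ∀ n, MeasurableSet (B n) := fun n =>
    (hA n).inter (measurableSet_le hk.norm measurable_const)
  have hBμ : ∀ n, μ (B n) < ∞ := fun n => (measure_mono inter_subset_left).trans_lt (hAμ n)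
  have hBmono : Monotone B := by
    intro i j hij x hx
    exact ⟨hmono hij hx.1, (show ‖k x‖ ≤ i from hx.2).trans (by exact_mod_cast hij)⟩
  have hBU : ⋃ n, B n = univ := by
    refine eq_univ_of_forall fun x => ?_
    obtain ⟨i, hi⟩ := mem_iUnion.1 (hU.symm ▸ mem_univ x : x ∈ ⋃ n, A n)
    obtain ⟨j, hj⟩ := exists_nat_ge ‖k x‖
    refine mem_iUnion.2 ⟨max i j, hmono (le_max_left i j) hi, hj.trans ?_⟩
    exact_mod_cast le_max_right i j
  have hph : Measurable fun x => starRingEnd ℂ (k x) / ‖k x‖ :=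
    (RCLike.continuous_conj.measurable.comp hk).div (Complex.measurable_ofReal.comp hk.norm)
  have hphn : ∀ x, ‖starRingEnd ℂ (k x) / ‖k x‖‖ ≤ 1 := by
    intro x
    rw [norm_div, RCLike.norm_conj, Complex.norm_real, norm_norm]
    exact div_self_le_one _
  have hphk : ∀ x, k x * (starRingEnd ℂ (k x) / ‖k x‖) = ‖k x‖ := by
    intro x
    rcases eq_or_ne (k x) 0 with h0 | h0
    · simp [h0]
    · have : (‖k x‖ : ℂ) ≠ 0 := by exact_mod_cast norm_ne_zero_iff.2 h0
      rw [← mul_div_assoc, Complex.mul_conj, Complex.normSq_eq_norm_sq]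
      field_simp
      push_cast
      ring
  rcases eq_or_ne q ∞ with hq | hq
  · subst hq
    have hp1 : p = 1 := by
      have := ENNReal.HolderConjugate.inv_add_inv_eq_one p ∞
      simpa using this
    subst hp1
    rw [eLpNorm_exponent_top]
    refine ENNReal.le_of_forall_pos_le_add fun ε hε _ => ?_
    rw [← ENNReal.ofReal_coe_nnreal, ← ENNReal.ofReal_add hC ε.coe_nonneg]
    refine eLpNormEssSup_le_of_ae_bound ?_
    -- Testing against the conjugate phase of `k` on the exceptional set `S` gives `(C + ε) μ(S) ≤ C
    -- μ(S)`, so `S` is null.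
    have hS : ∀ n, ∀ᵐ x ∂μ, x ∉ B n ∩ {x | C + ε < ‖k x‖} := by
      intro n
      set S := B n ∩ {x | C + ε < ‖k x‖} with hSdef
      have hSm : MeasurableSet S := (hBm n).inter (measurableSet_lt measurable_const hk.norm)
      have hSμ : μ S < ∞ := (measure_mono inter_subset_left).trans_lt (hBμ n)
      rw [← measure_eq_zero_iff_ae_notMem]
      set w : X → ℂ := S.indicator fun x => starRingEnd ℂ (k x) / ‖k x‖ with hw
      have hwn : ∀ x, ‖w x‖ ≤ S.indicator (fun _ => (1 : ℝ)) x := by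
        intro x
        by_cases hx : x ∈ S
        · simpa [hw, hx] using hphn x
        · simp [hw, hx]
      have hwm : Measurable w := hph.indicator hSm
      have hw1 : ∀ x, ‖w x‖ ≤ 1 := fun x =>
        (hwn x).trans (indicator_le_self' (fun _ _ => zero_le_one) x)
      have h1 := h n w hwm ⟨1, hw1⟩ (fun x hx => indicator_of_notMem (fun hx' => hx hx'.1.1) _)
      have h2 : ∫ x, k x * w x ∂μ = ((∫ x in S, ‖k x‖ ∂μ : ℝ) : ℂ) := by
        rw [← integral_indicator hSm, ← integral_complex_ofReal]
        refine integral_congr_ae (Eventually.of_forall fun x => ?_)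
        by_cases hx : x ∈ S
        · simpa [hw, hx] using hphk x
        · simp [hw, hx]
      have hwL : MemLp w 1 μ := memLp_of_bounded_of_support hwm hSm hSμ hw1
        (fun x hx => indicator_of_notMem hx _) 1
      have h3 : (eLpNorm w 1 μ).toReal ≤ μ.real S := by
        rw [← integral_norm_eq_toReal_eLpNorm hwL, ← integral_indicator_one hSm]
        exact integral_mono (memLp_one_iff_integrable.1 hwL).norm
          ((integrable_indicator_iff hSm).2 (integrableOn_const hSμ.ne)) hwn
      have hint : IntegrableOn (fun x => ‖k x‖) S μ := by
        refine Measure.integrableOn_of_bounded (M := n) hSμ.ne hk.norm.aestronglyMeasurable ?_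
        filter_upwards [ae_restrict_mem hSm] with x hx
        rw [norm_norm]
        exact hx.1.2
      have h4 : (C + ε) * μ.real S ≤ ∫ x in S, ‖k x‖ ∂μ :=
        setIntegral_ge_of_const_le_real hSm hSμ.ne (fun x hx => hx.2.le) hint
      rw [h2, Complex.norm_real] at h1
      have h5 : (C + ε) * μ.real S ≤ C * μ.real S :=
        h4.trans ((le_abs_self _).trans (h1.trans (by gcongr)))
      have hε' : (0 : ℝ) < ε := hε
      have h6 : μ.real S = 0 := by
        have : 0 ≤ μ.real S := measureReal_nonneg
        nlinarith
      exact (measureReal_eq_zero_iff hSμ.ne).1 h6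
    filter_upwards [ae_all_iff.2 hS] with x hx
    by_contra hcon
    obtain ⟨n, hn⟩ := mem_iUnion.1 (hBU.symm ▸ mem_univ x : x ∈ ⋃ n, B n)
    exact hx n ⟨hn, not_le.1 hcon⟩
  · have hpt : 1 < p := by
      refine lt_of_le_of_ne hp.out fun hp1 => hq ?_
      subst hp1
      have := ENNReal.HolderConjugate.inv_add_inv_eq_one 1 q
      simpa using this
    have hp0 : p ≠ 0 := (zero_lt_one.trans hpt).ne'
    have hq1 : 1 ≤ q := ENNReal.HolderConjugate.one_le q p
    have hq0 : q ≠ 0 := (zero_lt_one.trans_le hq1).ne'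
    have hr : p.toReal.HolderConjugate q.toReal :=
      ENNReal.HolderConjugate.toReal_of_ne_top hptop hq
    -- The extremal function is the conjugate phase times `|k|^(q-1)` on `B n`, with `|w|^p = |k|^q`
    -- there. Then `a ≤ C a^(1/p)` for the finite number `a`, the integral of `|k|^q` over `B n`,
    -- and dividing gives `a^(1/q) ≤ C`.
    have key : ∀ n, ∫⁻ x in B n, ‖k x‖ₑ ^ q.toReal ∂μ ≤ ENNReal.ofReal (C ^ q.toReal) := by
      intro n
      set w : X → ℂ := (B n).indicator fun x =>
        starRingEnd ℂ (k x) / ‖k x‖ * ((‖k x‖ ^ (q.toReal - 1) : ℝ) : ℂ) with hw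
      have hq1' : 0 < q.toReal - 1 := hr.symm.sub_one_pos
      have hwnorm : ∀ x, ‖w x‖ = (B n).indicator (fun x => ‖k x‖ ^ (q.toReal - 1)) x := by
        intro x
        by_cases hx : x ∈ B n
        · simp only [hw, hx, indicator_of_mem]
          rcases eq_or_ne (k x) 0 with h0 | h0
          · simp [h0, Real.zero_rpow hq1'.ne']
          · rw [norm_mul, norm_div, RCLike.norm_conj, Complex.norm_real, norm_norm,
              div_self (norm_ne_zero_iff.2 h0), one_mul, Complex.norm_real,
              Real.norm_of_nonneg (by positivity)]
        · simp [hw, hx]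
      have hwm : Measurable w :=
        (hph.mul (Complex.measurable_ofReal.comp (hk.norm.pow_const _))).indicator (hBm n)
      have hwbd : ∀ x, ‖w x‖ ≤ (n : ℝ) ^ (q.toReal - 1) := by
        intro x
        rw [hwnorm]
        by_cases hx : x ∈ B n
        · simp only [hx, indicator_of_mem]
          exact Real.rpow_le_rpow (norm_nonneg _) hx.2 hq1'.le
        · simp only [hx, not_false_eq_true, indicator_of_notMem]
          positivity
      have h1 := h n w hwm ⟨_, hwbd⟩ (fun x hx => indicator_of_notMem (fun hx' => hx hx'.1) _)
      set a : ℝ := ∫ x in B n, ‖k x‖ ^ q.toReal ∂μ with ha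
      have ha0 : 0 ≤ a := integral_nonneg fun x => by positivity
      have h2 : ∫ x, k x * w x ∂μ = (a : ℂ) := by
        rw [ha, ← integral_indicator (hBm n), ← integral_complex_ofReal]
        refine integral_congr_ae (Eventually.of_forall fun x => ?_)
        by_cases hx : x ∈ B n
        · simp only [hw, hx, indicator_of_mem]
          rw [← mul_assoc, hphk, ← Complex.ofReal_mul]
          congr 1
          rcases eq_or_ne ‖k x‖ 0 with h0 | h0
          · rw [h0, zero_mul, Real.zero_rpow (by linarith)]
          · rw [← Real.rpow_one_add' (norm_nonneg _) (by linarith), add_sub_cancel]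
        · simp [hw, hx]
      have hwL : MemLp w p μ := memLp_of_bounded_of_support hwm (hBm n) (hBμ n) hwbd
        (fun x hx => indicator_of_notMem hx _) p
      have h3 : (eLpNorm w p μ).toReal = a ^ p.toReal⁻¹ := by
        rw [hwL.eLpNorm_eq_integral_rpow_norm hp0 hptop, ENNReal.toReal_ofReal (by positivity),
          ha, ← integral_indicator (hBm n)]
        congr 1
        refine integral_congr_ae (Eventually.of_forall fun x => ?_)
        simp only [hwnorm]
        by_cases hx : x ∈ B n
        · simp only [hx, indicator_of_mem]
          rw [← Real.rpow_mul (norm_nonneg _), hr.symm.sub_one_mul_conj]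
        · simp only [hx, not_false_eq_true, indicator_of_notMem]
          exact Real.zero_rpow hr.pos.ne'
      rw [h2, h3, Complex.norm_real, Real.norm_of_nonneg ha0] at h1
      have h4 : a ≤ C ^ q.toReal := by
        rcases ha0.eq_or_lt with h0 | hapos
        · rw [← h0]
          positivity
        · have h5 : a ^ q.toReal⁻¹ ≤ C := by
            have h6 : a = a ^ q.toReal⁻¹ * a ^ p.toReal⁻¹ := by
              rw [← Real.rpow_add hapos, hr.symm.inv_add_inv_eq_one, Real.rpow_one]
            have h7 : 0 < a ^ p.toReal⁻¹ := by positivity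
            rw [h6] at h1
            exact le_of_mul_le_mul_right (by rwa [← h6] at h1 ⊢) h7
          calc a = (a ^ q.toReal⁻¹) ^ q.toReal := by
                rw [← Real.rpow_mul ha0, inv_mul_cancel₀ hr.symm.pos.ne', Real.rpow_one]
            _ ≤ _ := Real.rpow_le_rpow (by positivity) h5 hr.symm.nonneg
      have hint : IntegrableOn (fun x => ‖k x‖ ^ q.toReal) (B n) μ := by
        refine Measure.integrableOn_of_bounded (M := (n : ℝ) ^ q.toReal) (hBμ n).ne
          (hk.norm.pow_const _).aestronglyMeasurable ?_
        filter_upwards [ae_restrict_mem (hBm n)] with x hx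
        rw [Real.norm_of_nonneg (by positivity)]
        exact Real.rpow_le_rpow (norm_nonneg _) hx.2 hr.symm.nonneg
      calc _ = ∫⁻ x in B n, ENNReal.ofReal (‖k x‖ ^ q.toReal) ∂μ := by
            simp_rw [← ENNReal.ofReal_rpow_of_nonneg (norm_nonneg _) hr.symm.nonneg, ofReal_norm]
        _ = ENNReal.ofReal a :=
            (ofReal_integral_eq_lintegral_ofReal hint
              (Eventually.of_forall fun x => by positivity)).symm
        _ ≤ _ := ENNReal.ofReal_le_ofReal h4
    have h8 : ∫⁻ x, ‖k x‖ₑ ^ q.toReal ∂μ ≤ ENNReal.ofReal (C ^ q.toReal) := by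
      rw [← setLIntegral_univ, ← hBU, setLIntegral_iUnion_of_directed _
        (directed_of_isDirected_le hBmono)]
      exact iSup_le key
    rw [eLpNorm_eq_lintegral_rpow_enorm_toReal hq0 hq, one_div, ENNReal.rpow_inv_le_iff hr.symm.pos,
      ENNReal.ofReal_rpow_of_nonneg hC hr.symm.nonneg]
    exact h8

end LpDuality

/-! ### Riesz representation on `Lᵖ` and the operator `S* S`. -/

section LpRiesz

variable {X : Type*} [MeasurableSpace X] {μ : Measure X}

/-- The exponent `r` with `1 / r + 1 / 2 = 1 / p`. -/
theorem exists_holderTriple_two {p : ℝ≥0∞} (hp : 1 ≤ p) (hp2 : p < 2) :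
    ∃ r : ℝ≥0∞, r.HolderTriple 2 p ∧ 1 ≤ r ∧ r ≠ ∞ := by
  have h2 : (2 : ℝ≥0∞)⁻¹ < p⁻¹ := ENNReal.inv_lt_inv.2 hp2
  refine ⟨(p⁻¹ - 2⁻¹)⁻¹, ⟨?_⟩, ?_, ?_⟩
  · rw [inv_inv, tsub_add_cancel_of_le h2.le]
  · rw [ENNReal.one_le_inv]
    exact tsub_le_self.trans (ENNReal.inv_le_one.2 hp)
  · rw [ne_eq, ENNReal.inv_eq_top, tsub_eq_zero_iff_le, not_le]
    exact h2

/-- Take `h = g^(1/r)` for a positive integrable `g`. The superlevel sets of `g` exhaust the space,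
have finite measure by Chebyshev's inequality, and `1/h` is bounded on each. -/
theorem exists_pos_memLp [SigmaFinite μ] {r : ℝ≥0∞} (hr0 : r ≠ 0) (hr : r ≠ ∞) :
    ∃ (h : X → ℝ) (A : ℕ → Set X), Measurable h ∧ (∀ x, 0 < h x) ∧
      MemLp (fun x => (h x : ℂ)) r μ ∧ (∀ n, MeasurableSet (A n)) ∧ (∀ n, μ (A n) < ∞) ∧
      Monotone A ∧ ⋃ n, A n = univ ∧ ∀ n, ∃ M : ℝ, ∀ x ∈ A n, (h x)⁻¹ ≤ M := by
  obtain ⟨g, hg0, hgm, hg⟩ := exists_pos_lintegral_lt_of_sigmaFinite μ (one_ne_zero (α := ℝ≥0∞))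
  have hrr : 0 < r.toReal := ENNReal.toReal_pos hr0 hr
  have hhm : Measurable fun x => (g x : ℝ) ^ r.toReal⁻¹ := hgm.coe_nnreal_real.pow_const _
  have hinv : ∀ n : ℕ, ((n : ℝ≥0∞) + 1)⁻¹ ≠ 0 := fun n => by simp
  refine ⟨fun x => (g x : ℝ) ^ r.toReal⁻¹, fun n => {x | ((n : ℝ≥0∞) + 1)⁻¹ ≤ g x}, hhm,
    fun x => Real.rpow_pos_of_pos (hg0 x) _, ⟨(Complex.measurable_ofReal.comp hhm).aestronglyMeasurable, ?_⟩,
    fun n => measurableSet_le measurable_const hgm.coe_nnreal_ennreal, fun n => ?_, ?_, ?_, fun n => ?_⟩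
  · rw [eLpNorm_lt_top_iff_lintegral_rpow_enorm_lt_top hr0 hr]
    refine lt_of_eq_of_lt (lintegral_congr fun x => ?_) (hg.trans ENNReal.one_lt_top)
    rw [← ofReal_norm, Complex.norm_real, Real.norm_of_nonneg (by positivity),
      ENNReal.ofReal_rpow_of_nonneg (by positivity) hrr.le, ← Real.rpow_mul (by positivity),
      inv_mul_cancel₀ hrr.ne', Real.rpow_one, ENNReal.ofReal_coe_nnreal]
  · refine (meas_ge_le_lintegral_div hgm.coe_nnreal_ennreal.aemeasurable (hinv n)
      (by simp)).trans_lt ?_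
    exact ENNReal.div_lt_top (hg.trans ENNReal.one_lt_top).ne (hinv n)
  · intro i j hij x hx
    have hx : ((i : ℝ≥0∞) + 1)⁻¹ ≤ g x := hx
    refine le_trans ?_ hx
    have : (i : ℝ≥0∞) ≤ j := by exact_mod_cast hij
    gcongr
  · refine eq_univ_of_forall fun x => ?_
    have hgx : (g x : ℝ≥0∞) ≠ 0 := by exact_mod_cast (hg0 x).ne'
    obtain ⟨n, hn⟩ := ENNReal.exists_inv_nat_lt hgx
    refine mem_iUnion.2 ⟨n, ?_⟩
    have : ((n : ℝ≥0∞) + 1)⁻¹ ≤ (n : ℝ≥0∞)⁻¹ := ENNReal.inv_le_inv.2 le_self_add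
    exact this.trans hn.le
  · refine ⟨((n : ℝ) + 1) ^ r.toReal⁻¹, fun x hx => ?_⟩
    have hx : ((n : ℝ≥0∞) + 1)⁻¹ ≤ g x := hx
    rw [← Real.inv_rpow (by positivity)]
    refine Real.rpow_le_rpow (by positivity) ?_ (by positivity)
    have h1 : (g x : ℝ≥0∞)⁻¹ ≤ (n : ℝ≥0∞) + 1 := by
      rw [← inv_inv ((n : ℝ≥0∞) + 1)]
      exact ENNReal.inv_le_inv.2 hx
    have h2 := ENNReal.toReal_mono (by finiteness) h1
    rw [ENNReal.toReal_inv, ENNReal.coe_toReal] at h2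
    simpa [ENNReal.toReal_add] using h2

/-- The Riesz representation theorem for the dual of `Lᵖ`, `1 ≤ p < 2`. -/
theorem exists_integral_eq_of_Lp_dual [SigmaFinite μ] {p q : ℝ≥0∞} [hp : Fact (1 ≤ p)]
    [hq : Fact (1 ≤ q)] [hpq : p.HolderConjugate q] (hp2 : p < 2) (l : Lp ℂ p μ →L[ℂ] ℂ) :
    ∃ k : Lp ℂ q μ, ‖k‖ ≤ ‖l‖ ∧ ∀ v : Lp ℂ p μ, l v = ∫ x, k x * v x ∂μ := by
  have hpt : p ≠ ∞ := (hp2.trans ENNReal.ofNat_lt_top).ne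
  obtain ⟨r, hr2, hr1, hrt⟩ := exists_holderTriple_two hp.out hp2
  have : Fact (1 ≤ r) := ⟨hr1⟩
  obtain ⟨h, A, hhm, hh0, hhr, hA, hAμ, hmono, hU, hM⟩ :=
    exists_pos_memLp (μ := μ) (zero_lt_one.trans_le hr1).ne' hrt
  -- Multiplication by `h` maps `L²` to `Lᵖ` by Hölder, so `l` pulls back to `L²`, where the Hilbert
  -- space representation applies. Dividing the representative by `h` gives the density of `l`.
  set φ : Lp ℂ 2 μ →L[ℂ] ℂ :=
    l.comp ((ContinuousLinearMap.mul ℂ ℂ).holderL μ r 2 p (hhr.toLp _)) with hφ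
  set k₀ : Lp ℂ 2 μ := (InnerProductSpace.toDual ℂ (Lp ℂ 2 μ)).symm φ with hk₀
  set k : X → ℂ := fun x => starRingEnd ℂ (k₀ x) / h x with hk
  have hkm : Measurable k :=
    (RCLike.continuous_conj.measurable.comp (Lp.stronglyMeasurable k₀).measurable).div
      (Complex.measurable_ofReal.comp hhm)
  have hrep : ∀ n (w : X → ℂ) (_ : Measurable w) (_ : ∃ M : ℝ, ∀ x, ‖w x‖ ≤ M)
      (_ : ∀ x ∉ A n, w x = 0) (hw : MemLp w p μ), l (hw.toLp w) = ∫ x, k x * w x ∂μ := by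
    rintro n w hwm ⟨M, hwM⟩ hw0 hw
    obtain ⟨M', hM'⟩ := hM n
    set v : X → ℂ := fun x => w x / h x with hv
    have hvm : Measurable v := hwm.div (Complex.measurable_ofReal.comp hhm)
    have hvM : ∀ x, ‖v x‖ ≤ M * max M' 0 := by
      intro x
      have hM0 : 0 ≤ M := (norm_nonneg _).trans (hwM x)
      by_cases hx : x ∈ A n
      · rw [hv, norm_div, Complex.norm_real, Real.norm_of_nonneg (hh0 x).le, div_eq_mul_inv]
        have h1 := (hM' x hx).trans (le_max_left M' 0)
        have h2 : 0 ≤ (h x)⁻¹ := (inv_pos.2 (hh0 x)).le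
        exact mul_le_mul (hwM x) h1 h2 hM0
      · simp only [hv, hw0 x hx, zero_div, norm_zero]
        positivity
    have hv0 : ∀ x ∉ A n, v x = 0 := fun x hx => by simp [hv, hw0 x hx]
    have hv2 : MemLp v 2 μ := memLp_of_bounded_of_support hvm (hA n) (hAμ n) hvM hv0 2
    have hne : ∀ x, (h x : ℂ) ≠ 0 := fun x => by exact_mod_cast (hh0 x).ne'
    have h1 : (ContinuousLinearMap.mul ℂ ℂ).holderL μ r 2 p (hhr.toLp _) (hv2.toLp v) =
        hw.toLp w := by
      refine Lp.ext ?_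
      filter_upwards [(ContinuousLinearMap.mul ℂ ℂ).coeFn_holder (r := p) (hhr.toLp _) (hv2.toLp v),
        hhr.coeFn_toLp, hv2.coeFn_toLp, hw.coeFn_toLp] with x e1 e2 e3 e4
      rw [e4]
      refine e1.trans ?_
      rw [e2, e3, ContinuousLinearMap.mul_apply', hv, mul_div_cancel₀ _ (hne x)]
    have h2 : l (hw.toLp w) = φ (hv2.toLp v) := by rw [hφ, ContinuousLinearMap.comp_apply, h1]
    rw [h2, ← InnerProductSpace.toDual_symm_apply, L2.inner_def]
    refine integral_congr_ae ?_
    filter_upwards [hv2.coeFn_toLp] with x hx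
    rw [hx, RCLike.inner_apply, hk, hv]
    ring
  have hkq : eLpNorm k q μ ≤ ENNReal.ofReal ‖l‖ := by
    refine eLpNorm_le_of_forall_bounded (p := p) hkm hA hAμ hmono hU (norm_nonneg l) hpt ?_
    rintro n w hwm ⟨M, hwM⟩ hw0
    have hw := memLp_of_bounded_of_support hwm (hA n) (hAμ n) hwM hw0 p
    rw [← hrep n w hwm ⟨M, hwM⟩ hw0 hw, ← Lp.norm_toLp w hw]
    exact l.le_opNorm _
  have hkL : MemLp k q μ := ⟨hkm.aestronglyMeasurable, hkq.trans_lt ENNReal.ofReal_lt_top⟩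
  refine ⟨hkL.toLp k, ?_, ?_⟩
  · rw [Lp.norm_toLp]
    exact ENNReal.toReal_le_of_le_ofReal (norm_nonneg l) hkq
  set ψ := (ContinuousLinearMap.mul ℂ ℂ).lpPairing μ q p (hkL.toLp k) with hψ
  have hψapp : ∀ v : Lp ℂ p μ, ψ v = ∫ x, (hkL.toLp k : X → ℂ) x * v x ∂μ := fun v =>
    (ContinuousLinearMap.mul ℂ ℂ).lpPairing_eq_integral _ v
  suffices hl : ∀ v, l v = ψ v from fun v => (hl v).trans (hψapp v)
  refine Lp.induction hpt (fun v => l v = ψ v) ?_ ?_ (isClosed_eq l.continuous ψ.continuous)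
  · intro c s hs hsμ
    rw [Lp.simpleFunc.coe_indicatorConst]
    have hsn : ∀ n, MeasurableSet (s ∩ A n) := fun n => hs.inter (hA n)
    have hsnμ : ∀ n, μ (s ∩ A n) ≠ ∞ := fun n =>
      ((measure_mono inter_subset_left).trans_lt hsμ).ne
    -- The representation is known for bounded functions supported in some `A n`; a general set of
    -- finite measure is exhausted by its intersections with them.
    have hlim : Tendsto (fun n => indicatorConstLp p (hsn n) (hsnμ n) c) atTop
        (𝓝 (indicatorConstLp p hs hsμ.ne c)) := by
      refine tendsto_indicatorConstLp_set hpt ?_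
      have e : ∀ n, symmDiff (s ∩ A n) s = s \ A n := by
        intro n
        ext x
        simp only [mem_symmDiff, mem_inter_iff, Set.mem_sdiff]
        tauto
      simp_rw [e]
      have h3 := tendsto_measure_iInter_atTop (μ := μ) (s := fun n => s \ A n)
        (fun n => (hs.diff (hA n)).nullMeasurableSet)
        (fun i j hij => sdiff_subset_sdiff_right (hmono hij))
        ⟨0, ((measure_mono sdiff_subset).trans_lt hsμ).ne⟩
      rwa [← sdiff_iUnion, hU, sdiff_univ, measure_empty] at h3
    refine tendsto_nhds_unique ((l.continuous.tendsto _).comp hlim) ?_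
    refine ((ψ.continuous.tendsto _).comp hlim).congr fun n => ?_
    simp only [Function.comp_apply]
    rw [hψapp]
    have h4 := hrep n ((s ∩ A n).indicator fun _ => c) (measurable_const.indicator (hsn n))
      ⟨‖c‖, fun x => norm_indicator_le_norm_self _ _⟩
      (fun x hx => indicator_of_notMem (fun hx' => hx hx'.2) _)
      (memLp_indicator_const p (hsn n) c (Or.inr (hsnμ n)))
    refine Eq.trans ?_ h4.symm
    refine integral_congr_ae ?_
    filter_upwards [hkL.coeFn_toLp, indicatorConstLp_coeFn (p := p) (hs := hsn n) (hμs := hsnμ n)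
      (c := c)] with x e1 e2
    rw [e1, e2]
  · intro f g hf hg _ h1 h2
    rw [map_add, map_add, h1, h2]

/-- An element of `L^q` is determined by its integrals against `Lᵖ`. -/
theorem Lp_eq_of_forall_integral_eq [SigmaFinite μ] {p q : ℝ≥0∞} [hp : Fact (1 ≤ p)]
    [hq : Fact (1 ≤ q)] [hpq : p.HolderConjugate q] (hpt : p ≠ ∞) {k₁ k₂ : Lp ℂ q μ}
    (h : ∀ v : Lp ℂ p μ, ∫ x, k₁ x * v x ∂μ = ∫ x, k₂ x * v x ∂μ) : k₁ = k₂ := by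
  rw [← sub_eq_zero, ← norm_le_zero_iff, Lp.norm_def]
  have h1 : eLpNorm (k₁ - k₂ : Lp ℂ q μ) q μ ≤ ENNReal.ofReal 0 := by
    refine eLpNorm_le_of_forall_bounded (p := p) (Lp.stronglyMeasurable _).measurable
      (measurableSet_spanningSets μ) (measure_spanningSets_lt_top μ) (monotone_spanningSets μ)
      (iUnion_spanningSets μ) le_rfl hpt ?_
    rintro n w hwm ⟨M, hwM⟩ hw0
    have hw := memLp_of_bounded_of_support hwm (measurableSet_spanningSets μ n)
      (measure_spanningSets_lt_top μ n) hwM hw0 p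
    have h2 : ∀ k : Lp ℂ q μ, ∫ x, k x * hw.toLp w x ∂μ =
        (ContinuousLinearMap.mul ℂ ℂ).lpPairing μ q p k (hw.toLp w) := fun k =>
      ((ContinuousLinearMap.mul ℂ ℂ).lpPairing_eq_integral _ _).symm
    have h3 : ∫ x, (k₁ - k₂ : Lp ℂ q μ) x * w x ∂μ =
        ∫ x, (k₁ - k₂ : Lp ℂ q μ) x * hw.toLp w x ∂μ := by
      refine integral_congr_ae ?_
      filter_upwards [hw.coeFn_toLp] with x hx
      rw [hx]
    rw [h3, h2, map_sub, sub_apply, ← h2, ← h2, h, sub_self, norm_zero, zero_mul]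
  simpa using ENNReal.toReal_mono ENNReal.ofReal_ne_top h1

theorem exists_integral_conj_eq [SigmaFinite μ] {p q : ℝ≥0∞} [hp : Fact (1 ≤ p)]
    [hq : Fact (1 ≤ q)] [hpq : p.HolderConjugate q] (hp2 : p < 2) (l : Lp ℂ p μ →L[ℂ] ℂ) :
    ∃ k : Lp ℂ q μ, ‖k‖ ≤ ‖l‖ ∧
      ∀ v : Lp ℂ p μ, ∫ x, k x * starRingEnd ℂ (v x) ∂μ = starRingEnd ℂ (l v) := by
  obtain ⟨k, hk, hkv⟩ := exists_integral_eq_of_Lp_dual (q := q) hp2 l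
  refine ⟨star k, ?_, fun v => ?_⟩
  · refine le_trans (le_of_eq ?_) hk
    rw [Lp.norm_def, Lp.norm_def, eLpNorm_congr_ae (Lp.coeFn_star k)]
    congr 1
    refine eLpNorm_congr_norm_ae (Eventually.of_forall fun x => ?_)
    rw [Pi.star_apply, norm_star]
  · rw [hkv, ← integral_conj]
    refine integral_congr_ae ?_
    filter_upwards [Lp.coeFn_star k] with x hx
    rw [hx, Pi.star_apply, map_mul, RCLike.star_def]

theorem Lp_eq_of_forall_integral_conj_eq [SigmaFinite μ] {p q : ℝ≥0∞} [hp : Fact (1 ≤ p)]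
    [hq : Fact (1 ≤ q)] [hpq : p.HolderConjugate q] (hpt : p ≠ ∞) {k₁ k₂ : Lp ℂ q μ}
    (h : ∀ v : Lp ℂ p μ, ∫ x, k₁ x * starRingEnd ℂ (v x) ∂μ =
      ∫ x, k₂ x * starRingEnd ℂ (v x) ∂μ) : k₁ = k₂ := by
  refine Lp_eq_of_forall_integral_eq (p := p) hpt fun v => ?_
  have h1 : ∀ k : Lp ℂ q μ, ∫ x, k x * v x ∂μ =
      ∫ x, k x * starRingEnd ℂ ((star v : Lp ℂ p μ) x) ∂μ := by
    intro k
    refine integral_congr_ae ?_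
    filter_upwards [Lp.coeFn_star v] with x hx
    rw [hx, Pi.star_apply, RCLike.star_def, Complex.conj_conj]
  rw [h1, h1, h]

/-- The operator `S* S : Lᵖ → L^q` for an operator `S` from `Lᵖ` to a Hilbert space. -/
theorem exists_adjoint_mul_self [SigmaFinite μ] {p q : ℝ≥0∞} [hp : Fact (1 ≤ p)]
    [hq : Fact (1 ≤ q)] [hpq : p.HolderConjugate q] (hp2 : p < 2) {K : Type*}
    [NormedAddCommGroup K] [InnerProductSpace ℂ K] (S : Lp ℂ p μ →L[ℂ] K) :
    ∃ T : Lp ℂ p μ →L[ℂ] Lp ℂ q μ, ‖T‖ ≤ ‖S‖ ^ 2 ∧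
      ∀ u v : Lp ℂ p μ, ∫ x, T u x * starRingEnd ℂ (v x) ∂μ = inner ℂ (S v) (S u) := by
  have hpt : p ≠ ∞ := (hp2.trans ENNReal.ofNat_lt_top).ne
  have hex : ∀ u : Lp ℂ p μ, ∃ k : Lp ℂ q μ, ‖k‖ ≤ ‖S‖ ^ 2 * ‖u‖ ∧
      ∀ v : Lp ℂ p μ, ∫ x, k x * starRingEnd ℂ (v x) ∂μ = inner ℂ (S v) (S u) := by
    intro u
    obtain ⟨k, hk, hkv⟩ := exists_integral_conj_eq (q := q) hp2 ((innerSL ℂ (S u)).comp S)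
    refine ⟨k, hk.trans ?_, fun v => ?_⟩
    · refine ((innerSL ℂ (S u)).opNorm_comp_le S).trans ?_
      rw [innerSL_apply_norm, sq, mul_assoc, mul_comm]
      gcongr
      exact S.le_opNorm u
    · rw [hkv, ContinuousLinearMap.comp_apply, innerSL_apply_apply, inner_conj_symm]
  -- `T u` is chosen separately for each `u`; linearity follows because its integrals against `Lᵖ`
  -- determine it.
  choose T hTn hT using hex
  have hpair : ∀ (v : Lp ℂ p μ), ∃ ψ : Lp ℂ q μ →L[ℂ] ℂ,
      ∀ k : Lp ℂ q μ, ψ k = ∫ x, k x * starRingEnd ℂ (v x) ∂μ := by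
    intro v
    refine ⟨((ContinuousLinearMap.mul ℂ ℂ).lpPairing μ q p).flip (star v), fun k => ?_⟩
    refine ((ContinuousLinearMap.mul ℂ ℂ).lpPairing_eq_integral _ _).trans ?_
    refine integral_congr_ae ?_
    filter_upwards [Lp.coeFn_star v] with x hx
    rw [hx, Pi.star_apply, RCLike.star_def]
    rfl
  choose ψ hψ using hpair
  refine ⟨LinearMap.mkContinuous
    { toFun := T
      map_add' := fun u u' => ?_
      map_smul' := fun c u => ?_ } (‖S‖ ^ 2) hTn, LinearMap.mkContinuous_norm_le _ (by positivity) _,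
    fun u v => hT u v⟩
  · refine Lp_eq_of_forall_integral_conj_eq (p := p) hpt fun v => ?_
    rw [hT, ← hψ v (T u + T u'), map_add (ψ v), hψ, hψ, hT, hT, map_add, inner_add_right]
  · refine Lp_eq_of_forall_integral_conj_eq (p := p) hpt fun v => ?_
    rw [RingHom.id_apply, hT, ← hψ v (c • T u), map_smul (ψ v), hψ, hT, map_smul,
      inner_smul_right, smul_eq_mul]

end LpRiesz

/-! ### From localized quadratic forms to the operator. -/

section Assembly

/-- If one function grows at most as fast as another to the right of a point, then so do their
derivatives at this point. -/
theorem HasDerivAt.le_of_sub_le {a b : ℝ → ℝ} {a' b' x : ℝ} (ha : HasDerivAt a a' x)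
    (hb : HasDerivAt b b' x) (h : ∀ t, x ≤ t → a t - a x ≤ b t - b x) : a' ≤ b' := by
  refine le_of_tendsto_of_tendsto ha.tendsto_slope_zero_right hb.tendsto_slope_zero_right ?_
  filter_upwards [self_mem_nhdsWithin] with t ht
  have ht : 0 < t := ht
  have := h (x + t) (by linarith)
  simp only [smul_eq_mul]
  gcongr

theorem HasDerivAt.complex_re {a : ℝ → ℂ} {a' : ℂ} {x : ℝ} (ha : HasDerivAt a a' x) :
    HasDerivAt (fun t => (a t).re) a'.re x :=
  Complex.reCLM.hasFDerivAt.comp_hasDerivAt x ha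

/-- An operator partition of unity reduces the estimate of a spectral density to the estimates of
its localized parts. -/
theorem IsProjectionFamily.re_deriv_le_of_partition {H : Type*} [NormedAddCommGroup H]
    [InnerProductSpace ℂ H] [CompleteSpace H] {E : ℝ → H →L[ℂ] H} (hE : IsProjectionFamily E)
    {N : ℕ} {Q : ℕ → H →L[ℂ] H}
    (hQ : ∑ i ∈ Finset.range N, Q i = ContinuousLinearMap.id ℂ H) {lam : ℝ} {f : H} {d : ℂ}
    (hd : HasSpectralDensityAt E lam f f d) {c : ℕ → ℂ}
    (hc : ∀ i < N, HasSpectralDensityAt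
      (fun t => (Q i).comp ((E t).comp (ContinuousLinearMap.adjoint (Q i)))) lam f f (c i)) :
    d.re ≤ N * ∑ i ∈ Finset.range N, (c i).re := by
  set g : ℕ → H := fun i => ContinuousLinearMap.adjoint (Q i) f with hg
  have hsum : ∑ i ∈ Finset.range N, g i = f := by
    have h1 := congrArg (fun A => ContinuousLinearMap.adjoint A f) hQ
    simp only [map_sum, sum_apply, ContinuousLinearMap.adjoint_id, ContinuousLinearMap.id_apply] at h1
    exact h1
  have happ : ∀ i t, inner ℂ f ((Q i).comp ((E t).comp (ContinuousLinearMap.adjoint (Q i))) f) =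
      inner ℂ (g i) (E t (g i)) := by
    intro i t
    rw [hg, ContinuousLinearMap.adjoint_inner_left]
    rfl
  -- On the diagonal, increments to the right of `lam` are squared norms. They obey Cauchy-Schwarz
  -- for `f = ∑ g i`, and the inequality passes to the derivatives at `lam`.
  have hinc : ∀ (v : H) (t : ℝ), lam ≤ t → (inner ℂ v (E t v)).re - (inner ℂ v (E lam v)).re =
      ‖(E t - E lam) v‖ ^ 2 := by
    intro v t ht
    rw [← Complex.sub_re, ← inner_sub_right, ← sub_apply,
      (hE.isStarProjection_sub ht).inner_self_apply, Complex.ofReal_re]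
  have hb : HasDerivAt (fun t => (N : ℝ) * ∑ i ∈ Finset.range N, (inner ℂ (g i) (E t (g i))).re)
      (N * ∑ i ∈ Finset.range N, (c i).re) lam := by
    refine HasDerivAt.const_mul _ (HasDerivAt.fun_sum fun i hi => ?_)
    have h2 := HasDerivAt.complex_re (hc i (Finset.mem_range.1 hi))
    simpa only [happ] using h2
  refine (HasDerivAt.complex_re hd).le_of_sub_le hb fun t ht => ?_
  rw [hinc f t ht, ← mul_sub, ← Finset.sum_sub_distrib,
    Finset.sum_congr rfl fun i _ => hinc (g i) t ht]
  conv_lhs => rw [← hsum, map_sum]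
  calc ‖∑ i ∈ Finset.range N, (E t - E lam) (g i)‖ ^ 2
      ≤ (∑ i ∈ Finset.range N, ‖(E t - E lam) (g i)‖) ^ 2 := by
        gcongr
        exact norm_sum_le _ _
    _ ≤ _ := by
        simpa using sq_sum_le_card_mul_sum_sq (s := Finset.range N)
          (f := fun i => ‖(E t - E lam) (g i)‖)

variable {X : Type*} [MeasurableSpace X] {μ : Measure X}

/-- A spectral density which factors through a Hilbert space and is bounded in the sense of
quadratic forms on `Lᵖ` defines a bounded operator from `Lᵖ` to its antidual. -/
theorem SpectralFactorization.exists_operator [SigmaFinite μ] {E : ℝ → Lp ℂ 2 μ →L[ℂ] Lp ℂ 2 μ}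
    {D : Submodule ℂ (Lp ℂ 2 μ)} (hD : IsTestSpace D) {K : Type*} [NormedAddCommGroup K]
    [InnerProductSpace ℂ K] [CompleteSpace K] {P : ℝ → K →ₗ[ℂ] (D →ₗ⋆[ℂ] ℂ)}
    {Pstar : ℝ → D →ₗ[ℂ] K} (hP : SpectralFactorization E D P Pstar) {p q : ℝ≥0∞}
    [hp : Fact (1 ≤ p)] [hq : Fact (1 ≤ q)] [hpq : p.HolderConjugate q] (hp2 : p < 2) {lam M : ℝ}
    (hlam : 0 < lam) (hM : 0 ≤ M)
    (hbd : ∀ f : D, ‖Pstar lam f‖ ^ 2 ≤ 2 * Real.pi * M * (eLpNorm (f : Lp ℂ 2 μ) p μ).toReal ^ 2) :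
    ∃ T : Lp ℂ p μ →L[ℂ] Lp ℂ q μ, IsSpectralMeasureOperator E D lam T ∧ ‖T‖ ≤ M := by
  have hpi := Real.pi_pos
  have hdense := hD.denseRange_toLp hp.out hp2.le
  have hnorm : ∀ f : D, ‖Pstar lam f‖ ≤ √(2 * Real.pi * M) * ‖hD.toLp p hp.out hp2.le f‖ := by
    intro f
    rw [hD.norm_toLp]
    refine abs_le_of_sq_le_sq' ?_ (by positivity) |>.2
    rw [mul_pow, Real.sq_sqrt (by positivity)]
    exact hbd f
  -- The quadratic form bound is an `Lᵖ` bound for `P(lam)*`, which extends by density to `S`; the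
  -- density is then `(2π)⁻¹ S* S`.
  set S := (Pstar lam).extendOfNorm (hD.toLp p hp.out hp2.le) with hS
  have hSapp : ∀ f : D, S (hD.toLp p hp.out hp2.le f) = Pstar lam f := fun f =>
    LinearMap.extendOfNorm_eq hdense ⟨_, hnorm⟩ f
  have hSn : ‖S‖ ≤ √(2 * Real.pi * M) :=
    LinearMap.opNorm_extendOfNorm_le hdense (Real.sqrt_nonneg _) hnorm
  obtain ⟨T, hTn, hT⟩ := exists_adjoint_mul_self (q := q) hp2 S
  refine ⟨(1 / (2 * (Real.pi : ℂ))) • T, ?_, ?_⟩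
  · intro f hf g hg u hu
    have h1 := (hP lam hlam).2 ⟨f, hf⟩ ⟨g, hg⟩
    rw [(hP lam hlam).1] at h1
    convert h1 using 1
    have hu' : u = hD.toLp p hp.out hp2.le ⟨f, hf⟩ :=
      Lp.ext (hu.trans (hD.coeFn_toLp hp.out hp2.le ⟨f, hf⟩).symm)
    rw [← hSapp, ← hSapp, ← hT, hu', ← integral_const_mul]
    refine integral_congr_ae ?_
    filter_upwards [hD.coeFn_toLp hp.out hp2.le ⟨g, hg⟩,
      Lp.coeFn_smul (1 / (2 * (Real.pi : ℂ))) (T (hD.toLp p hp.out hp2.le ⟨f, hf⟩))] with x h2 h3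
    rw [smul_apply, h3, Pi.smul_apply, smul_eq_mul, h2, mul_assoc]
  · rw [norm_smul]
    have h4 : ‖T‖ ≤ 2 * Real.pi * M := by
      refine hTn.trans ?_
      calc ‖S‖ ^ 2 ≤ √(2 * Real.pi * M) ^ 2 := by gcongr
        _ = _ := Real.sq_sqrt (by positivity)
    have h5 : ‖(1 / (2 * (Real.pi : ℂ)))‖ = (2 * Real.pi)⁻¹ := by
      rw [one_div, norm_inv, norm_mul, Complex.norm_real, Real.norm_of_nonneg hpi.le]
      norm_num
    rw [h5]
    calc _ ≤ (2 * Real.pi)⁻¹ * (2 * Real.pi * M) := by gcongr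
      _ = M := by field_simp

/-- Outside of the essential spectrum the spectral density vanishes. -/
theorem IsTestSpace.isSpectralMeasureOperator_zero {E : ℝ → Lp ℂ 2 μ →L[ℂ] Lp ℂ 2 μ}
    (hE : IsProjectionFamily E) {D : Submodule ℂ (Lp ℂ 2 μ)} (hD : IsTestSpace D) {lam : ℝ}
    (hlam : lam ∉ essSpectrum E)
    (hcont : ∀ f ∈ D, ContinuousAt (fun t => inner ℂ f (E t f)) lam) {p q : ℝ≥0∞}
    [Fact (1 ≤ p)] [Fact (1 ≤ q)] :
    IsSpectralMeasureOperator E D lam (0 : Lp ℂ p μ →L[ℂ] Lp ℂ q μ) := by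
  intro f _ g _ u _
  have h0 : ∫ z, (((0 : Lp ℂ p μ →L[ℂ] Lp ℂ q μ) u : Lp ℂ q μ) : X → ℂ) z *
      starRingEnd ℂ (g z) ∂μ = 0 := by
    rw [← integral_zero X ℂ (μ := μ)]
    refine integral_congr_ae ?_
    filter_upwards [Lp.coeFn_zero ℂ q μ] with x hx
    rw [zero_apply, hx, Pi.zero_apply, zero_mul]
  rw [h0]
  have hev := hE.eventually_eq_of_notMem_essSpectrum hD.dense hlam hcont
  refine (hasDerivAt_const lam (inner ℂ g (E lam f))).congr_of_eventuallyEq ?_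
  filter_upwards [hev] with t ht
  rw [ht]

end Assembly

/-! ### The restriction theorem. -/

theorem theorem1p1 {X : Type*} [MetricSpace X] [MeasurableSpace X] [BorelSpace X]
    (μ : Measure X) [SigmaFinite μ] (n : ℕ)
    (L : Lp ℂ 2 μ →ₗ.[ℂ] Lp ℂ 2 μ) (hL : IsSelfAdjoint L)
    (hLpos : ∀ f : L.domain, 0 ≤ (inner ℂ (f : Lp ℂ 2 μ) (L f)).re)
    (D : Submodule ℂ (Lp ℂ 2 μ)) (hD : IsTestSpace D)
    {K : Type*} [NormedAddCommGroup K] [InnerProductSpace ℂ K] [CompleteSpace K]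
    (P : ℝ → K →ₗ[ℂ] (D →ₗ⋆[ℂ] ℂ)) (Pstar : ℝ → D →ₗ[ℂ] K)
    (hP : SpectralFactorization (sqrtSpectralProj L) D P Pstar)
    (N : ℝ → ℕ) (Q : ℝ → ℕ → Lp ℂ 2 μ →L[ℂ] Lp ℂ 2 μ) (hQ : OperatorPartition N Q)
    (w : X → X → ℝ) (hw : ∀ z z', 0 ≤ w z z')
    (δ C₀ : ℝ) (hδ : 0 < δ) (hδ1 : δ < 1)
    (hest : SpectralMeasureEstimates n (sqrtSpectralProj L) D N Q w δ C₀) :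
    ∃ C : ℝ, ∀ (p q : ℝ≥0∞) [Fact (1 ≤ p)] [Fact (1 ≤ q)], p.HolderConjugate q →
      p ≤ ENNReal.ofReal (2 * ((n : ℝ) + 1) / ((n : ℝ) + 3)) →
      ∀ lam : ℝ, 0 < lam → ∃ T : Lp ℂ p μ →L[ℂ] Lp ℂ q μ,
        IsSpectralMeasureOperator (sqrtSpectralProj L) D lam T ∧
        ‖T‖ ≤ C * lam ^ ((n : ℝ) * (1 / p.toReal - 1 / q.toReal) - 1) := by
  set E := sqrtSpectralProj L
  have hE : IsProjectionFamily E := isProjectionFamily_sqrtSpectralProj L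
  obtain ⟨⟨N₀, hN₀⟩, ⟨B, hB⟩, hsum⟩ := hQ
  have hest' := hest.mono hw hδ1 (le_max_left C₀ 0)
  set R := restrictionConst n δ B (max C₀ 0)
  have hR : 0 ≤ R := restrictionConst_nonneg n δ B (le_max_right _ _)
  -- One factor `N₀` is lost to Cauchy-Schwarz over the partition, the other counts its terms.
  refine ⟨N₀ * (N₀ * R), fun p q hp hq hpq hple lam hlam => ?_⟩
  by_cases hess : lam ∈ essSpectrum E
  swap
  · refine ⟨0, hD.isSpectralMeasureOperator_zero hE hess fun f hf => ?_, ?_⟩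
    · exact ((hP lam hlam).2 ⟨f, hf⟩ ⟨f, hf⟩).continuousAt
    · rw [norm_zero]
      positivity
  have hpt : p ≠ ∞ := ne_top_of_le_ne_top ENNReal.ofReal_ne_top hple
  have hp1 : 1 ≤ p.toReal := by simpa using ENNReal.toReal_mono hpt hp.out
  have hpn : p.toReal ≤ 2 * ((n : ℝ) + 1) / (n + 3) := by
    have := ENNReal.toReal_mono ENNReal.ofReal_ne_top hple
    rwa [ENNReal.toReal_ofReal (by positivity)] at this
  have hpn' : p.toReal * (n + 3) ≤ 2 * (n + 1) := by
    rwa [le_div_iff₀ (by positivity)] at hpn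
  -- For `n = 0` the upper limit is `2/3`, so no `p ≥ 1` is admissible.
  have hn : 1 ≤ n := by
    by_contra hn
    have : n = 0 := by omega
    subst this
    push_cast at hpn'
    linarith
  have hp2' : p.toReal < 2 := by nlinarith
  have hp2 : p < 2 := by
    rw [← ENNReal.ofReal_toReal hpt, ← ENNReal.ofReal_ofNat]
    exact (ENNReal.ofReal_lt_ofReal_iff two_pos).2 hp2'
  -- The interpolation parameter: `1/p = (1 - θ)/2 + θ`, and `θ = 1/p - 1/q`.
  set θ := 2 / p.toReal - 1 with hθ
  have hp0 : 0 < p.toReal := by linarith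
  have hpθ : p.toReal * (1 + θ) = 2 := by
    rw [hθ]
    field_simp
    ring
  have hθ0 : 0 < θ := by
    rw [hθ, sub_pos, one_lt_div hp0]
    exact hp2'
  have hθ1 : θ ≤ 1 := by nlinarith
  have hnθ : 2 ≤ θ * (n + 1) := by
    have h1 : p.toReal * (θ * (n + 1) - 2) = 2 * (n + 1) - p.toReal * (n + 3) := by
      linear_combination ((n : ℝ) + 1) * hpθ
    nlinarith
  have hexp : 1 / p.toReal - 1 / q.toReal = θ := by
    have h1 := congrArg ENNReal.toReal (ENNReal.HolderConjugate.inv_add_inv_eq_one p q)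
    rw [ENNReal.toReal_add (by simpa using (zero_lt_one.trans_le hp.out).ne')
      (by simpa using (zero_lt_one.trans_le hq.out).ne'), ENNReal.toReal_inv, ENNReal.toReal_inv,
      ENNReal.toReal_one] at h1
    rw [hθ, one_div, one_div, div_eq_mul_inv]
    linarith
  rw [hexp]
  refine hP.exists_operator hD hp2 hlam (by positivity) fun f => ?_
  have hloc : ∀ i < N lam, ∃ c : ℂ, _ := fun i hi =>
    hest'.norm_deriv_le hE hD hw hδ hδ1 (le_max_right _ _) hn hpt hθ0 hθ1 hpθ hnθ hlam hess hi
      (hB lam hlam i hi) f.2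
  choose! c hc hcn using hloc
  have hd := (hP lam hlam).2 f f
  rw [(hP lam hlam).1] at hd
  have hre := hE.re_deriv_le_of_partition (hsum lam hlam) hd hc
  have e1 : ((1 / (2 * (Real.pi : ℂ))) * inner ℂ (Pstar lam f) (Pstar lam f)).re =
      (2 * Real.pi)⁻¹ * ‖Pstar lam f‖ ^ 2 := by
    rw [inner_self_eq_norm_sq_to_K, ← Complex.ofReal_re ((2 * Real.pi)⁻¹ * ‖Pstar lam f‖ ^ 2)]
    push_cast
    rw [one_div]
    rfl
  rw [e1] at hre
  have hNle : (N lam : ℝ) ≤ N₀ := by exact_mod_cast hN₀ lam hlam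
  set Z := R * lam ^ (n * θ - 1) * (eLpNorm (f : Lp ℂ 2 μ) p μ).toReal ^ 2 with hZ
  have hZ0 : 0 ≤ Z := by positivity
  have h2 : ∑ i ∈ Finset.range (N lam), (c i).re ≤ N₀ * Z := by
    calc _ ≤ ∑ i ∈ Finset.range (N lam), Z := Finset.sum_le_sum fun i hi =>
          (Complex.re_le_norm _).trans (hcn i (Finset.mem_range.1 hi))
      _ = N lam * Z := by simp
      _ ≤ _ := by gcongr
  have h3 : (2 * Real.pi)⁻¹ * ‖Pstar lam f‖ ^ 2 ≤ N₀ * (N₀ * Z) :=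
    calc _ ≤ (N lam : ℝ) * ∑ i ∈ Finset.range (N lam), (c i).re := hre
      _ ≤ N lam * (N₀ * Z) := by gcongr
      _ ≤ N₀ * (N₀ * Z) := by gcongr
  have hpi : 0 < 2 * Real.pi := by positivity
  rw [inv_mul_le_iff₀ hpi] at h3
  refine h3.trans (le_of_eq ?_)
  rw [hZ]
  ring
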